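/- Let $K$ be a field with $2\neq 0$ in $K$, and let $X,Y,q\in K$ with $q\ne 0$ and $q^{2j}\neq 1$ for all $j\ge 1$ (for instance, let $X,Y,q$ be indeterminates and $K=\mathbb{Q}(X,Y,q)$). For $v\in\mathbb Z$ put $w_v=\tfrac12\left(Xq^{v}+Yq^{-v}\right)$, and write $(z;Q)_m=\prod_{j=0}^{m-1}(1-zQ^j)$. *Paths.* Consider lattice paths in $\mathbb Z\times\mathbb Z$ with steps $(a,b)\to(a+1,b)$ to the right, of weight $w_{a-2b}$, and downward steps $(a,b)\to(a,b-1)$, of weight $1$; the weight of a path is the product of the weights of its steps. For integers $a,c\ge 0$ let $\mathbf{gf}(a,c)$ be the sum of the weights of all lattice paths from $(a,a)$ to $(c,0)$. *Tilings.* For integers $x,N\ge 0$, the half hexagon of width $x$ and height $N$ is the trapezoid in the triangular lattice with horizontal upper side of length $x$, lateral sides of length $N$ and lower side of length $x+N$. Number its $N$ horizontal rows of triangles by $x,x+1,\dots,x+N-1$ from top to bottom. A left (right) dent in row $r$ is the removal of the unit triangle of row $r$ which is adjacent to the left (right) lateral side. A vertical lozenge is one whose two triangles share a horizontal side; vertical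 lozenges carry labels which are constant vertically, increase by $1$ from each column of vertical lozenges to the next one on its right, and are $0$ on the vertical symmetry axis of the half hexagon. The weight of a lozenge tiling is the product of $w_v$ over the labels $v$ of its vertical lozenges. For $n$-tuples $\mathbf a=(a_1<\dots<a_n)$, $\mathbf c=(c_1<\dots<c_n)$ with $x\le a_i$ and $c_i<x+N$ for all $i$, let $M_{x,N}(\mathbf a,\mathbf c)$ be the sum of the weights of all lozenge tilings of the half hexagon of width $x$ and height $N$ with right dents exactly in the rows $c_1,\dots,c_n$ and left dents exactly in the rows different from $a_1,\dots,a_n$. **Theorem.** Let $n\ge 0$ and $k\ge 1$, and let $a_1<\dots<a_n$ and $c_1<\dots<c_n$ be non-negative integers with $a_i\le c_i$ for all $i$. Put $$F=\prod_{l=1}^n\left(\frac{(q^{2k};q^2)_{c_l+1}}{q^{k c_l}\,(q^2;q^2)_{c_l}}\cdot\frac{q^{k a_l}\,(q^2;q^2)_{a_l}}{(q^{2k};q^2)_{a_l+1}}\right),\qquad D=\det\left(\mathbf{gf}(a_i,c_j)\right)_{i,j=1}^n ,$$ so that $F$ does not involve $X$ and $Y$. 1. $\det\left(\mathbf{gf}(a_i+k,c_j+k)\right)_{i,j=1}^n=F\cdot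 D$. Moreover $D\neq 0$ if $X,Y,q$ are algebraically independent over $\mathbb Z$ (in particular if they are indeterminates over $\mathbb Q$), and whenever $D\ne0$, $$\frac{\det\left(\mathbf{gf}(a_i+k,c_j+k)\right)_{i,j=1}^n}{\det\left(\mathbf{gf}(a_i,c_j)\right)_{i,j=1}^n}=F .$$ 2. $D$ is the generating function of all families $(P_1,\dots,P_n)$ of lattice paths, $P_i$ from $(a_i,a_i)$ to $(c_i,0)$, no two of which have a lattice point in common, where the weight of a family is the product of the weights of its paths. 3. For all integers $x,N\ge0$ with $x\le a_i$ and $c_i<x+N$ for all $i$, one has $M_{x,N}(\mathbf a,\mathbf c)=D$. If only the width is changed, from $x$ to $x+k$, then the tiling generating function changes by the factor $F$: writing $\mathbf a+k=(a_i+k)_i$ and $\mathbf c+k=(c_i+k)_i$, $$M_{x+k,N}(\mathbf a+k,\mathbf c+k)=F\cdot M_{x,N}(\mathbf a,\mathbf c),$$ and the quotient of the two generating functions is $F$ whenever $M_{x,N}(\mathbf a,\mathbf c)\neq 0$. -/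

import Mathlib

open scoped BigOperators

noncomputable section

namespace HalfHexagon

/-! ### q-Pochhammer symbols and weights -/

/-- The q-Pochhammer symbol `(z; Q)_n`, i.e. the product of `1 - z * Q ^ j` for `0 ≤ j < n`. -/
def qPoch {K : Type*} [Field K] (z Q : K) (n : ℕ) : K :=
  ∏ j ∈ Finset.range n, (1 - z * Q ^ j)

/-- The weight `(X q^v + Y q^(-v)) / 2` of a label `v`. -/
def labelWeight {K : Type*} [Field K] (X Y q : K) (v : ℤ) : K :=
  (X * q ^ v + Y * q ^ (-v)) / 2

/-! ### Lattice paths with steps to the right and downwards -/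

/-- The two kinds of steps of a lattice path. -/
inductive Step : Type
  | right : Step
  | down : Step

/-- The point of `ℤ × ℤ` reached from `P` by one step. -/
def Step.move : Step → ℤ × ℤ → ℤ × ℤ
  | Step.right, P => (P.1 + 1, P.2)
  | Step.down, P => (P.1, P.2 - 1)

/-- The end point of the walk that starts in `P` and performs the given steps. -/
def endpoint : ℤ × ℤ → List Step → ℤ × ℤ
  | P, [] => P
  | P, s :: w => endpoint (s.move P) w

/-- The list of all lattice points visited by the walk that starts in `P`. -/
def points : ℤ × ℤ → List Step → List (ℤ × ℤ)
  | P, [] => [P]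
  | P, s :: w => P :: points (s.move P) w

/-- The weight of a single step that starts in `P = (a, b)`: a step to the right has label
`a - 2 b`, a downward step has weight `1`. -/
def stepWeight {K : Type*} [Field K] (X Y q : K) (P : ℤ × ℤ) : Step → K
  | Step.right => labelWeight X Y q (P.1 - 2 * P.2)
  | Step.down => 1

/-- The weight of a walk that starts in `P`: the product of the weights of its steps. -/
def walkWeight {K : Type*} [Field K] (X Y q : K) : ℤ × ℤ → List Step → K
  | _, [] => 1
  | P, s :: w => stepWeight X Y q P s * walkWeight X Y q (s.move P) w

/-- The lattice paths from `P` to `Q`. -/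
def LatticePath (P Q : ℤ × ℤ) : Type :=
  {w : List Step // endpoint P w = Q}

theorem length_eq_of_endpoint (w : List Step) (P : ℤ × ℤ) :
    (w.length : ℤ) = ((endpoint P w).1 - P.1) + (P.2 - (endpoint P w).2) := by
  induction w generalizing P with
  | nil => simp [endpoint]
  | cons s w ih =>
    have h := ih (s.move P)
    cases s <;> simp only [endpoint, Step.move, List.length_cons, Nat.cast_add,
      Nat.cast_one] at h ⊢ <;> linarith

instance : Finite Step :=
  Finite.of_injective (fun s : Step => match s with | Step.right => true | Step.down => false)
    (by intro s t; cases s <;> cases t <;> simp)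

/-- There are only finitely many lattice paths between two given points. -/
instance (P Q : ℤ × ℤ) : Finite (LatticePath P Q) := by
  have h : {w : List Step | endpoint P w = Q}.Finite := by
    refine (List.finite_length_eq Step ((Q.1 - P.1) + (P.2 - Q.2)).toNat).subset ?_
    intro w hw
    have h1 := length_eq_of_endpoint w P
    have h2 : endpoint P w = Q := hw
    rw [h2] at h1
    simp only [Set.mem_ofPred_eq]
    omega
  exact h.to_subtype

instance (P Q : ℤ × ℤ) : Fintype (LatticePath P Q) := Fintype.ofFinite _

/-- The weight of a lattice path. -/
def LatticePath.weight {K : Type*} [Field K] (X Y q : K) {P Q : ℤ × ℤ}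
    (p : LatticePath P Q) : K :=
  walkWeight X Y q P p.1

/-- The generating function `gf(a, c)` of all lattice paths from `(a, a)` to `(c, 0)`. -/
def gf {K : Type*} [Field K] (X Y q : K) (a c : ℕ) : K :=
  ∑ p : LatticePath ((a : ℤ), (a : ℤ)) ((c : ℤ), 0), p.weight X Y q

/-- The matrix of the path generating functions `gf(a_i, c_j)`. -/
def gfMatrix {K : Type*} [Field K] (X Y q : K) {n : ℕ} (a c : Fin n → ℕ) :
    Matrix (Fin n) (Fin n) K :=
  Matrix.of fun i j => gf X Y q (a i) (c j)

/-- Families of non-intersecting lattice paths: the `i`-th path runs from `(a_i, a_i)` to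
`(c_i, 0)`, and no two of the paths have a lattice point in common. -/
def NonIntersectingFamily {n : ℕ} (a c : Fin n → ℕ) : Type :=
  {F : (i : Fin n) → LatticePath ((a i : ℤ), (a i : ℤ)) ((c i : ℤ), 0) //
    ∀ i j, i ≠ j →
      List.Disjoint (points ((a i : ℤ), (a i : ℤ)) (F i).1)
        (points ((a j : ℤ), (a j : ℤ)) (F j).1)}

instance {n : ℕ} (a c : Fin n → ℕ) : Finite (NonIntersectingFamily a c) :=
  Subtype.finite

instance {n : ℕ} (a c : Fin n → ℕ) : Fintype (NonIntersectingFamily a c) :=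
  Fintype.ofFinite _

/-- The generating function of all families of non-intersecting lattice paths, where the weight
of a family is the product of the weights of its members. -/
def familyGF {K : Type*} [Field K] (X Y q : K) {n : ℕ} (a c : Fin n → ℕ) : K :=
  ∑ F : NonIntersectingFamily a c, ∏ i, (F.1 i).weight X Y q

/-! ### Lozenge tilings of half hexagons with lateral dents

The vertices of the triangular lattice are written `V(r, s)` with integers `r`, `s`; the integer
`r` numbers the horizontal lattice lines from top to bottom, and `s` the vertices of one line from
left to right, in such a way that the two lower neighbours of `V(r, s)` are `V(r + 1, s)` and
`V(r + 1, s + 1)`. So `V(r, s)` has the horizontal coordinate `s - r / 2` (in units of the side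
length of the triangles), and the vertical line through `V(0, 0)` is the axis of symmetry. -/

/-- The unit triangles: `up r s` points upwards and has the vertices
`V(r, s)`, `V(r + 1, s)`, `V(r + 1, s + 1)`; `down r s` points downwards and has the vertices
`V(r, s)`, `V(r, s + 1)`, `V(r + 1, s + 1)`. Both lie between the lines `r` and `r + 1`. -/
inductive Triangle : Type
  | up : ℤ → ℤ → Triangle
  | down : ℤ → ℤ → Triangle
  deriving DecidableEq

/-- The three kinds of lozenges. -/
inductive Shape : Type
  | vertical : Shape
  | rightTilted : Shape
  | leftTilted : Shape
  deriving DecidableEq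

/-- A lozenge, given by its shape and by its upward pointing triangle `up row pos`. -/
@[ext]
structure Lozenge : Type where
  shape : Shape
  row : ℤ
  pos : ℤ
  deriving DecidableEq

/-- The upward pointing half of a lozenge. -/
def Lozenge.upper (l : Lozenge) : Triangle := Triangle.up l.row l.pos

/-- The downward pointing half of a lozenge. It shares the horizontal side of `up r s` in a
vertical lozenge, the right side in a right-tilted and the left side in a left-tilted one. -/
def Lozenge.partner (l : Lozenge) : Triangle :=
  match l.shape with
  | Shape.vertical => Triangle.down (l.row + 1) l.pos
  | Shape.rightTilted => Triangle.down l.row l.pos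
  | Shape.leftTilted => Triangle.down l.row (l.pos - 1)

/-- The two unit triangles of which a lozenge consists. -/
def Lozenge.cells (l : Lozenge) : Finset Triangle := {l.upper, l.partner}

/-- A lozenge tiling of a finite region: lozenges inside the region which cover each of its
triangles exactly once. -/
def IsTiling (R : Finset Triangle) (T : Finset Lozenge) : Prop :=
  (∀ l ∈ T, l.cells ⊆ R) ∧ ∀ t ∈ R, ∃! l, l ∈ T ∧ t ∈ l.cells

/-- The lozenge tilings of a finite region. -/
def Tiling (R : Finset Triangle) : Type := {T : Finset Lozenge // IsTiling R T}

instance : Finite Shape :=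
  Finite.of_injective
    (fun s : Shape => match s with
      | Shape.vertical => (0 : Fin 3) | Shape.rightTilted => 1 | Shape.leftTilted => 2)
    (by intro s t; cases s <;> cases t <;> simp)

/-- A finite region has only finitely many lozenge tilings. -/
instance (R : Finset Triangle) : Finite (Tiling R) := by
  have h1 : {l : Lozenge | l.upper ∈ R}.Finite := by
    refine Set.Finite.of_injOn (f := fun l : Lozenge => (l.shape, l.upper))
      (t := (Set.univ : Set Shape) ×ˢ (R : Set Triangle)) ?_ ?_
      (Set.finite_univ.prod R.finite_toSet)
    · intro l hl
      exact ⟨Set.mem_univ _, hl⟩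
    · intro l _ m _ hlm
      simp only [Lozenge.upper, Prod.mk.injEq, Triangle.up.injEq] at hlm
      exact Lozenge.ext hlm.1 hlm.2.1 hlm.2.2
  have h2 : {T : Finset Lozenge | IsTiling R T}.Finite := by
    refine (h1.toFinset.powerset.finite_toSet).subset ?_
    intro T hT
    simp only [Finset.coe_powerset, Set.mem_preimage, Set.mem_powerset_iff]
    intro l hl
    have h3 : l.upper ∈ R := hT.1 l hl (by simp [Lozenge.cells])
    simpa using h3
  exact h2.to_subtype

instance (R : Finset Triangle) : Fintype (Tiling R) := Fintype.ofFinite _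

/-- The weight of a lozenge: `1` unless it is vertical; a vertical lozenge with top vertex
`V(r, s)` has the label `2 s - r`. This label is constant along vertical lines, increases by `1`
from each column of vertical lozenges to the next one on its right, and is `0` on the axis of
symmetry. -/
def Lozenge.weight {K : Type*} [Field K] (X Y q : K) (l : Lozenge) : K :=
  match l.shape with
  | Shape.vertical => labelWeight X Y q (2 * l.pos - l.row)
  | Shape.rightTilted => 1
  | Shape.leftTilted => 1

/-- The generating function of all lozenge tilings of a region, where the weight of a tiling is
the product of the weights of its lozenges. -/
def tilingGF {K : Type*} [Field K] (X Y q : K) (R : Finset Triangle) : K :=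
  ∑ T : Tiling R, ∏ l ∈ T.1, l.weight X Y q

/-- The half hexagon with upper side of length `x` (the width), two lateral sides of length `N`
and lower side of length `x + N`: its upper side lies on the line `x`, its lower side on the line
`x + N`, and it is the part between these lines of the triangle with top vertex `V(0, 0)`. -/
def halfHexagon (x N : ℕ) : Finset Triangle :=
  (Finset.Ico x (x + N)).biUnion fun r =>
    (Finset.range (r + 1)).image (fun s : ℕ => Triangle.up (r : ℤ) (s : ℤ)) ∪
      (Finset.range r).image (fun s : ℕ => Triangle.down (r : ℤ) (s : ℤ))

/-- The half hexagon with lateral dents: the triangle of row `r` adjacent to the left lateral side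
is removed for all `r ∈ L`, the one adjacent to the right lateral side for all `r ∈ R`. (The rows
of the half hexagon are numbered from `x` to `x + N - 1`, from top to bottom.) -/
def dentedHalfHexagon (x N : ℕ) (L R : Finset ℕ) : Finset Triangle :=
  (halfHexagon x N \ L.image fun r : ℕ => Triangle.up (r : ℤ) 0) \
    R.image fun r : ℕ => Triangle.up (r : ℤ) (r : ℤ)

/-- The half hexagon of width `x` and lateral side length `N` which has dents on the right in the
rows `c_1, …, c_n`, and dents on the left in all rows except `a_1, …, a_n`. -/
def dentedRegion (x N : ℕ) {n : ℕ} (a c : Fin n → ℕ) : Finset Triangle :=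
  dentedHalfHexagon x N (Finset.Ico x (x + N) \ Finset.univ.image a) (Finset.univ.image c)

/-! ### The factor -/

/-- The factor by which the generating functions change; it does not involve `X` and `Y`. -/
def widthFactor {K : Type*} [Field K] (q : K) (k : ℕ) {n : ℕ} (a c : Fin n → ℕ) : K :=
  ∏ l, (qPoch (q ^ (2 * k)) (q ^ 2) (c l + 1) / (q ^ (k * c l) * qPoch (q ^ 2) (q ^ 2) (c l))) *
    ((q ^ (k * a l) * qPoch (q ^ 2) (q ^ 2) (a l)) / qPoch (q ^ (2 * k)) (q ^ 2) (a l + 1))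

end HalfHexagon

end

open scoped BigOperators

noncomputable section

namespace HalfHexagon

/-! ### Path generating functions between arbitrary points -/

/-! The factor $F$ comes from a closed form for single paths. The generating function of the paths
from $(a,b)$ to $(a+d,0)$ is $q^{-bd}$ times the $q^2$-binomial coefficient of $b+d$ over $b$ times
$\prod_{i<d} w_{a-b+i}$ (`pathGF_product`, with denominators cleared). For a start $(a,a)$ the
product of weights is $\prod_{i<d} w_i$ with $d=c-a$, so it is unchanged when $a$ and $c$ both grow
by $k$. Only Pochhammer symbols and powers of $q$ change, and they split into a factor of $c$ and a
factor of $a$ (`gf_add_eq`). The determinant then scales by rows and columns.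

For the combinatorial interpretations, note that every step raises $x-y$ by one and all starting
points lie on $x-y=0$. All paths therefore move in lockstep and can meet only at equal times.
Expanding the determinant multilinearly over the first steps gives a recursion from level $t$ to
level $t+1$. A step changes the first coordinate by 0 or 1, so paths cannot change order without
colliding, and a collision makes two rows equal. Hence no signs occur, and no sign-reversing
involution is needed. Non-intersecting families satisfy the same recursion
(`disjointFamilyGF_eq_det`).

So do tilings, cut into diagonal strips. A right step is a vertical lozenge, a downward step a
right-tilted one, and left-tilted lozenges fill what the paths leave free. One strip records one
simultaneous step (`exists_validSteps_and_subset_iff`), which leads to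
`tilingGF_stripRegion_eq_det`.

Nonvanishing for algebraically independent $X,Y,q$ is a positivity argument. Path weights become,
after clearing powers of 2 and $q$, integer polynomials positive at $(1,1,1)$, and at least one
non-intersecting family exists. -/

instance : Fintype Step where
  elems := ⟨{Step.right, Step.down}, by simp⟩
  complete s := by cases s <;> simp

theorem sum_step {M : Type*} [AddCommMonoid M] (f : Step → M) :
    ∑ s, f s = f Step.right + f Step.down := by
  change Multiset.sum _ = _
  simp [Finset.univ, Fintype.elems]

/-- The generating function of all lattice paths from `P` to `Q`. -/
def pathGF {K : Type*} [Field K] (X Y q : K) (P Q : ℤ × ℤ) : K :=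
  ∑ p : LatticePath P Q, p.weight X Y q

/-- A lattice path between distinct points splits off its first step. -/
def LatticePath.consEquiv {P Q : ℤ × ℤ} (h : P ≠ Q) :
    (Σ s : Step, LatticePath (s.move P) Q) ≃ LatticePath P Q where
  toFun p := ⟨p.1 :: p.2.1, p.2.2⟩
  invFun p := match p with
    | ⟨[], hp⟩ => (h hp).elim
    | ⟨s :: w, hp⟩ => ⟨s, ⟨w, hp⟩⟩
  left_inv _ := rfl
  right_inv p := match p with
    | ⟨[], hp⟩ => (h hp).elim
    | ⟨_ :: _, _⟩ => rfl

theorem endpoint_bounds (w : List Step) (P : ℤ × ℤ) :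
    P.1 ≤ (endpoint P w).1 ∧ (endpoint P w).2 ≤ P.2 := by
  induction w generalizing P with
  | nil => simp [endpoint]
  | cons s w ih =>
    have h := ih (s.move P)
    cases s <;> simp only [endpoint, Step.move] at h ⊢ <;> omega

theorem LatticePath.length_eq {P Q : ℤ × ℤ} (p : LatticePath P Q) :
    (p.1.length : ℤ) = (Q.1 - P.1) + (P.2 - Q.2) := by
  have h := length_eq_of_endpoint p.1 P
  rwa [p.2] at h

instance (P : ℤ × ℤ) : Unique (LatticePath P P) where
  default := ⟨[], rfl⟩
  uniq p := by
    have h := p.length_eq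
    have h1 : p.1.length = 0 := by omega
    exact Subtype.ext (List.length_eq_zero_iff.1 h1)

theorem isEmpty_latticePath {P Q : ℤ × ℤ} (h : Q.1 < P.1 ∨ P.2 < Q.2) :
    IsEmpty (LatticePath P Q) :=
  ⟨fun p => by
    have h1 := endpoint_bounds p.1 P
    rw [p.2] at h1
    omega⟩

section PathGF

variable {K : Type*} [Field K] (X Y q : K)

theorem pathGF_step {P Q : ℤ × ℤ} (h : P ≠ Q) :
    pathGF X Y q P Q = ∑ s : Step, stepWeight X Y q P s * pathGF X Y q (s.move P) Q := by
  simp only [pathGF, Finset.mul_sum]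
  rw [← Fintype.sum_sigma']
  exact (Fintype.sum_equiv (LatticePath.consEquiv h) _ _ fun p => rfl).symm

theorem pathGF_self (P : ℤ × ℤ) : pathGF X Y q P P = 1 := by
  rw [pathGF, Fintype.sum_unique]
  rfl

theorem pathGF_eq_zero {P Q : ℤ × ℤ} (h : Q.1 < P.1 ∨ P.2 < Q.2) : pathGF X Y q P Q = 0 := by
  have := isEmpty_latticePath h
  rw [pathGF, Fintype.sum_empty]

theorem pathGF_right_down {a b : ℤ} {Q : ℤ × ℤ} (h : (a, b) ≠ Q) :
    pathGF X Y q (a, b) Q =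
      labelWeight X Y q (a - 2 * b) * pathGF X Y q (a + 1, b) Q + pathGF X Y q (a, b - 1) Q := by
  rw [pathGF_step X Y q h, sum_step]
  simp [stepWeight, Step.move]

theorem pathGF_vertical (a : ℤ) (b : ℕ) : pathGF X Y q (a, (b : ℤ)) (a, 0) = 1 := by
  induction b with
  | zero => exact pathGF_self X Y q _
  | succ b ih =>
    rw [pathGF_right_down, pathGF_eq_zero X Y q (P := (a + 1, _)) (by simp)]
    · simpa using ih
    · simp only [ne_eq, Prod.mk.injEq, not_and]; push_cast; omega

/-! ### The product formula -/

theorem qPoch_succ (z Q : K) (n : ℕ) : qPoch z Q (n + 1) = qPoch z Q n * (1 - z * Q ^ n) :=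
  Finset.prod_range_succ _ _

theorem qPoch_add (z Q : K) (m n : ℕ) :
    qPoch z Q (m + n) = qPoch z Q m * qPoch (z * Q ^ m) Q n := by
  simp only [qPoch, Finset.prod_range_add, pow_add, mul_assoc]

variable {q}

theorem qPoch_ne_zero (hq : ∀ j : ℕ, 0 < j → q ^ (2 * j) ≠ 1) {k : ℕ} (hk : 0 < k) (n : ℕ) :
    qPoch (q ^ (2 * k)) (q ^ 2) n ≠ 0 := by
  refine Finset.prod_ne_zero_iff.2 fun j _ h => hq (k + j) (by omega) ?_
  rw [← pow_mul, ← pow_add, ← mul_add, sub_eq_zero] at h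
  exact h.symm

/-- The coefficients of $X$ and of $Y$ telescope separately. This is the weighted $q$-Pascal rule
that drives the induction for `pathGF_product`. -/
theorem labelWeight_identity (h2 : (2 : K) ≠ 0) (hq0 : q ≠ 0) (m : ℤ) (b d : ℕ) :
    (1 - q ^ (2 * (b + d))) * labelWeight X Y q m =
      q ^ b * ((1 - q ^ (2 * d)) * labelWeight X Y q (m - b)) +
        q ^ d * ((1 - q ^ (2 * b)) * labelWeight X Y q (m + d)) := by
  simp only [labelWeight, neg_add, sub_eq_add_neg, zpow_add₀ hq0, zpow_neg, zpow_natCast,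
    neg_neg]
  have := zpow_ne_zero m hq0
  field_simp
  ring

/-- Double induction on width and height: a right step lowers `d`, a downward step lowers `b`. With
the denominators cleared, $q$ may even be a root of unity. -/
theorem pathGF_product (h2 : (2 : K) ≠ 0) (hq0 : q ≠ 0) (a : ℤ) (b d : ℕ) :
    pathGF X Y q (a, (b : ℤ)) (a + d, 0) *
        (q ^ (b * d) * qPoch (q ^ 2) (q ^ 2) b * qPoch (q ^ 2) (q ^ 2) d) =
      qPoch (q ^ 2) (q ^ 2) (b + d) * ∏ i ∈ Finset.range d, labelWeight X Y q (a - b + i) := by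
  induction d generalizing a b with
  | zero => simp [pathGF_vertical, qPoch]
  | succ d ihd =>
    induction b with
    | zero =>
      rw [pathGF_right_down _ _ _ (by simp; omega),
        pathGF_eq_zero X Y q (P := (a, _)) (by simp), Finset.prod_range_succ']
      have h := ihd (a + 1) 0
      have e : a + 1 + (d : ℤ) = a + ((d + 1 : ℕ) : ℤ) := by push_cast; ring
      rw [e] at h
      simp only [Nat.cast_zero, sub_zero, zero_mul, pow_zero, one_mul, zero_add, mul_zero,
        add_zero, Nat.cast_add, Nat.cast_one, add_assoc, add_comm (1 : ℤ)] at h ⊢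
      rw [qPoch_succ, show qPoch (q ^ 2) (q ^ 2) 0 = 1 by simp [qPoch]] at *
      linear_combination (labelWeight X Y q a * (1 - q ^ 2 * (q ^ 2) ^ d)) * h
    | succ b ihb =>
      rw [pathGF_right_down _ _ _ (by simp; omega)]
      have h := ihd (a + 1) (b + 1)
      have e : a + 1 + (d : ℤ) = a + ((d + 1 : ℕ) : ℤ) := by push_cast; ring
      have e' : ((b + 1 : ℕ) : ℤ) - 1 = b := by push_cast; ring
      rw [e] at h
      rw [e']
      have h1 : ∏ i ∈ Finset.range d, labelWeight X Y q (a + 1 - ((b + 1 : ℕ) : ℤ) + i) =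
          ∏ i ∈ Finset.range d, labelWeight X Y q (a - b + i) :=
        Finset.prod_congr rfl fun i _ => by congr 1; push_cast; ring
      have h2' : ∏ i ∈ Finset.range (d + 1), labelWeight X Y q (a - ((b + 1 : ℕ) : ℤ) + i) =
          labelWeight X Y q (a - b - 1) *
            ∏ i ∈ Finset.range d, labelWeight X Y q (a - b + i) := by
        rw [Finset.prod_range_succ', mul_comm]
        congr 1
        · congr 1; push_cast; ring
        · exact Finset.prod_congr rfl fun i _ => by congr 1; push_cast; ring
      rw [h1] at h
      rw [h2']
      rw [Finset.prod_range_succ] at ihb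
      -- All three label products share the factors $w_{a-b+i}$, $i<d$. What remains is $w_{a-b-1}$
      -- in the claim, the weight $w_{a-2(b+1)}$ of the right step, and the last factor $w_{a-b+d}$
      -- of `ihb`.
      have key := labelWeight_identity X Y h2 hq0 (a - b - 1) (b + 1) (d + 1)
      have e1 : a - b - 1 - ((b + 1 : ℕ) : ℤ) = a - 2 * ((b + 1 : ℕ) : ℤ) := by push_cast; ring
      have e2 : a - b - 1 + ((d + 1 : ℕ) : ℤ) = a - b + d := by push_cast; ring
      rw [e1, e2] at key
      rw [show b + 1 + d = b + (d + 1) by ring] at h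
      rw [show b + 1 + (d + 1) = b + (d + 1) + 1 by ring] at key ⊢
      rw [qPoch_succ _ _ b] at *
      rw [qPoch_succ _ _ d] at *
      rw [qPoch_succ _ _ (b + (d + 1))]
      have s (m : ℕ) : q ^ 2 * (q ^ 2) ^ m = q ^ (2 * (m + 1)) := by ring
      simp only [s] at *
      linear_combination (q ^ (b + 1) * (1 - q ^ (2 * (d + 1))) *
        labelWeight X Y q (a - 2 * ((b + 1 : ℕ) : ℤ))) * h +
        (q ^ (d + 1) * (1 - q ^ (2 * (b + 1)))) * ihb -
        qPoch (q ^ 2) (q ^ 2) (b + (d + 1)) *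
          (∏ i ∈ Finset.range d, labelWeight X Y q (a - b + i)) * key

/-! ### Translation by `k` and the width factor -/

/-- The dependence of the width factor on one of the end points. -/
def endFactor (q : K) (k m : ℕ) : K :=
  qPoch (q ^ (2 * k)) (q ^ 2) (m + 1) / (q ^ (k * m) * qPoch (q ^ 2) (q ^ 2) m)

theorem widthFactor_eq (q : K) (k : ℕ) {n : ℕ} (a c : Fin n → ℕ) :
    widthFactor q k a c = (∏ l, endFactor q k (c l)) * ∏ l, (endFactor q k (a l))⁻¹ := by
  rw [← Finset.prod_mul_distrib]
  simp only [widthFactor, endFactor, inv_div]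

theorem gf_add_eq (h2 : (2 : K) ≠ 0) (hq0 : q ≠ 0) (hq : ∀ j : ℕ, 0 < j → q ^ (2 * j) ≠ 1)
    {k : ℕ} (hk : 0 < k) (a c : ℕ) :
    gf X Y q (a + k) (c + k) = (endFactor q k a)⁻¹ * (endFactor q k c * gf X Y q a c) := by
  obtain hac | hac := lt_or_ge c a
  · have h1 : gf X Y q (a + k) (c + k) = 0 := pathGF_eq_zero X Y q (by left; simpa using hac)
    have h3 : gf X Y q a c = 0 := pathGF_eq_zero X Y q (by left; simpa using hac)
    rw [h1, h3]; simp
  obtain ⟨d, rfl⟩ := Nat.exists_eq_add_of_le hac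
  have f (m : ℕ) : qPoch (q ^ 2) (q ^ 2) m ≠ 0 := by
    simpa using qPoch_ne_zero hq one_pos m
  have hp (m : ℕ) : gf X Y q m (m + d) = qPoch (q ^ 2) (q ^ 2) (m + d) *
      (∏ i ∈ Finset.range d, labelWeight X Y q i) /
        (q ^ (m * d) * qPoch (q ^ 2) (q ^ 2) m * qPoch (q ^ 2) (q ^ 2) d) := by
    rw [eq_div_iff (mul_ne_zero (mul_ne_zero (pow_ne_zero _ hq0) (f m)) (f d))]
    have h := pathGF_product X Y h2 hq0 m m d
    simp only [sub_self, zero_add] at h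
    rw [← h, gf, pathGF]
    norm_cast
  -- The first $k-1$ factors do not depend on `m` and cancel between $a$ and $c$. Since $k\ge1$,
  -- exactly $m+1$ factors are left, whence the index $m+1$ in `endFactor`.
  have hk' (m : ℕ) : qPoch (q ^ 2) (q ^ 2) (m + k) =
      qPoch (q ^ 2) (q ^ 2) (k - 1) * qPoch (q ^ (2 * k)) (q ^ 2) (m + 1) := by
    rw [show m + k = (k - 1) + (m + 1) by omega, qPoch_add]
    congr 2
    rw [← pow_mul, ← pow_add]
    congr 1; omega
  have g (m : ℕ) := qPoch_ne_zero hq hk (m + 1)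
  rw [show a + d + k = a + k + d by ring, hp, hp, show a + k + d = a + d + k by ring, hk', hk',
    endFactor, endFactor]
  have := f (k - 1)
  have := f a
  have := f d
  have := f (a + d)
  have := g a
  field_simp
  ring

theorem det_gfMatrix_add (h2 : (2 : K) ≠ 0) (hq0 : q ≠ 0)
    (hq : ∀ j : ℕ, 0 < j → q ^ (2 * j) ≠ 1) {k : ℕ} (hk : 0 < k) {n : ℕ} (a c : Fin n → ℕ) :
    (gfMatrix X Y q (fun i => a i + k) (fun i => c i + k)).det =
      widthFactor q k a c * (gfMatrix X Y q a c).det := by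
  have h : gfMatrix X Y q (fun i => a i + k) (fun i => c i + k) =
      Matrix.of fun i j => (endFactor q k (a i))⁻¹ *
        (Matrix.of fun i j => endFactor q k (c j) * gfMatrix X Y q a c i j) i j := by
    ext i j
    exact gf_add_eq X Y h2 hq0 hq hk (a i) (c j)
  rw [h, Matrix.det_mul_column, Matrix.det_mul_row, widthFactor_eq]
  ring

end PathGF


/-! ### The determinant of path generating functions, step by step

All starting points are taken on one line `x - y = t`; a step leads to the line
`x - y = t + 1`. -/

/-- The point of the line `x - y = t` with the first coordinate `r`. -/
def levelPoint (t r : ℤ) : ℤ × ℤ := (r, r - t)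

/-- The effect of a step on the first coordinate. -/
def Step.advance : Step → ℤ → ℤ
  | Step.right, r => r + 1
  | Step.down, r => r

theorem Step.move_levelPoint (s : Step) (t r : ℤ) :
    s.move (levelPoint t r) = levelPoint (t + 1) (s.advance r) := by
  cases s <;> simp only [Step.move, levelPoint, Step.advance, Prod.mk.injEq, true_and] <;> ring

theorem Step.le_advance (s : Step) (r : ℤ) : r ≤ s.advance r := by
  cases s <;> simp [Step.advance]

theorem Step.advance_le (s : Step) (r : ℤ) : s.advance r ≤ r + 1 := by
  cases s <;> simp [Step.advance]

/-- Distinct integers differ by at least 1 and a step adds at most 1, so paths may collide but never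
pass each other. -/
theorem monotone_advance {n : ℕ} {r : Fin n → ℤ} (hr : StrictMono r) (σ : Fin n → Step) :
    Monotone fun i => (σ i).advance (r i) := by
  intro i j hij
  obtain rfl | h := hij.eq_or_lt
  · rfl
  · have h1 := (σ i).advance_le (r i)
    have h2 := (σ j).le_advance (r j)
    have h3 := hr h
    simp only
    omega

section PathMatrix

variable {K : Type*} [Field K] (X Y q : K)

/-- The matrix of the path generating functions from `(r_i, r_i - t)` to `(c_j, 0)`. -/
def pathMatrix (t : ℤ) {n : ℕ} (r c : Fin n → ℤ) : Matrix (Fin n) (Fin n) K :=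
  Matrix.of fun i j => pathGF X Y q (levelPoint t (r i)) (c j, 0)

/-- The weight of a choice of simultaneous steps. -/
def stepsWeight (t : ℤ) {n : ℕ} (r : Fin n → ℤ) (σ : Fin n → Step) : K :=
  ∏ i, stepWeight X Y q (levelPoint t (r i)) (σ i)

theorem levelPoint_ne {t r c : ℤ} (h : t < c) : levelPoint t r ≠ (c, 0) := by
  simp only [levelPoint, ne_eq, Prod.mk.injEq, not_and]; omega

theorem det_pathMatrix_step {t : ℤ} {n : ℕ} (r c : Fin n → ℤ) (hc : ∀ j, t < c j) :
    (pathMatrix X Y q t r c).det = ∑ σ : Fin n → Step, stepsWeight X Y q t r σ *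
      (pathMatrix X Y q (t + 1) (fun i => (σ i).advance (r i)) c).det := by
  have h : pathMatrix X Y q t r c = fun i => ∑ s : Step,
      stepWeight X Y q (levelPoint t (r i)) s •
        fun j => pathGF X Y q (levelPoint (t + 1) (s.advance (r i))) (c j, 0) := by
    ext i j
    rw [Finset.sum_apply]
    simp only [Pi.smul_apply, smul_eq_mul, ← Step.move_levelPoint]
    exact pathGF_step X Y q (levelPoint_ne (hc j))
  rw [h]
  -- Viewed as a multilinear map of its rows, the determinant expands over all choices of first
  -- steps, and the step weights factor out.
  change (Matrix.detRowAlternating.toMultilinearMap fun i => _) = _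
  rw [MultilinearMap.map_sum]
  refine Finset.sum_congr rfl fun σ _ => ?_
  rw [MultilinearMap.map_smul_univ]
  rfl

theorem det_pathMatrix_eq_zero_of_row {t : ℤ} {n : ℕ} {r c : Fin n → ℤ} (i : Fin n)
    (h : r i < t ∨ ∀ j, c j < r i) : (pathMatrix X Y q t r c).det = 0 := by
  refine Matrix.det_eq_zero_of_row_eq_zero i fun j => pathGF_eq_zero X Y q ?_
  simp only [levelPoint]
  obtain h | h := h
  · omega
  · have := h j; omega

theorem det_pathMatrix_eq_zero_of_column {t : ℤ} {n : ℕ} {r c : Fin n → ℤ} (j : Fin n)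
    (hj : c j = t) (h : ∀ i, r i ≠ t) : (pathMatrix X Y q t r c).det = 0 := by
  refine Matrix.det_eq_zero_of_column_eq_zero j fun i => pathGF_eq_zero X Y q ?_
  have := h i
  simp only [levelPoint]
  omega

theorem det_pathMatrix_eq_zero_of_not_injective {t : ℤ} {n : ℕ} {r c : Fin n → ℤ}
    (h : ¬ Function.Injective r) : (pathMatrix X Y q t r c).det = 0 := by
  simp only [Function.Injective, not_forall] at h
  obtain ⟨i, j, hij, hne⟩ := h
  refine Matrix.det_zero_of_row_eq hne ?_
  ext k
  simp [pathMatrix, hij]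

/-- The first path starts at its end point $(t,0)$, and all other paths start to the right of it. So
the first column is $(1,0,\dots,0)$. -/
theorem det_pathMatrix_stop {t : ℤ} {n : ℕ} {r c : Fin (n + 1) → ℤ} (hr : StrictMono r)
    (hr0 : r 0 = t) (hc0 : c 0 = t) : (pathMatrix X Y q t r c).det =
      (pathMatrix X Y q t (fun i => r i.succ) fun i => c i.succ).det := by
  rw [Matrix.det_succ_column_zero, Fin.sum_univ_succ, Finset.sum_eq_zero]
  · have h : pathMatrix X Y q t r c 0 0 = 1 := by
      simp [pathMatrix, levelPoint, hr0, hc0, pathGF_self]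
    rw [h]
    simp only [Fin.val_zero, pow_zero, one_mul, add_zero, Fin.succAbove_zero]
    rfl
  · intro i _
    have h1 := hr (Fin.succ_pos i)
    have h : pathMatrix X Y q t r c i.succ 0 = 0 :=
      pathGF_eq_zero X Y q (by simp only [levelPoint]; omega)
    rw [h]; simp

/-! ### Families of non-intersecting paths -/

/-- No two paths of the family have a point in common. -/
def IsDisjointFamily {n : ℕ} {P Q : Fin n → ℤ × ℤ} (F : ∀ i, LatticePath (P i) (Q i)) : Prop :=
  ∀ i j, i ≠ j → List.Disjoint (points (P i) (F i).1) (points (P j) (F j).1)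

open Classical in
/-- The generating function of the families of non-intersecting lattice paths with given starting
points and end points. -/
def disjointFamilyGF {n : ℕ} (P Q : Fin n → ℤ × ℤ) : K :=
  ∑ F : ∀ i, LatticePath (P i) (Q i), if IsDisjointFamily F then ∏ i, (F i).weight X Y q else 0

theorem familyGF_eq {n : ℕ} (a c : Fin n → ℕ) : familyGF X Y q a c =
    disjointFamilyGF X Y q (fun i => ((a i : ℤ), (a i : ℤ))) fun i => ((c i : ℤ), 0) := by
  classical
  rw [disjointFamilyGF, ← Finset.sum_filter, familyGF]
  exact (Finset.sum_subtype _ (fun F => by rw [Finset.mem_filter_univ]; rfl)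
    fun F : ∀ i, LatticePath ((a i : ℤ), (a i : ℤ)) ((c i : ℤ), 0) =>
      ∏ i, (F i).weight X Y q).symm

theorem self_mem_points (P : ℤ × ℤ) (w : List Step) : P ∈ points P w := by
  cases w <;> simp [points]

theorem eq_or_lt_of_mem_points {w : List Step} {P R : ℤ × ℤ} (h : R ∈ points P w) :
    R = P ∨ P.1 - P.2 < R.1 - R.2 := by
  induction w generalizing P with
  | nil => exact Or.inl (by simpa [points] using h)
  | cons s w ih =>
    simp only [points, List.mem_cons] at h
    refine h.imp_right fun h => ?_
    have h1 := ih h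
    cases s <;> simp only [Step.move] at h1
    all_goals
      obtain rfl | h1 := h1
      · simp only; omega
      · omega

theorem disjointFamilyGF_eq_zero {n : ℕ} {P Q : Fin n → ℤ × ℤ} (h : ¬ Function.Injective P) :
    disjointFamilyGF X Y q P Q = 0 := by
  simp only [Function.Injective, not_forall] at h
  obtain ⟨i, j, hij, hne⟩ := h
  refine Finset.sum_eq_zero fun F _ => if_neg fun hF => ?_
  refine hF i j hne (self_mem_points _ _) ?_
  rw [hij]
  exact self_mem_points _ _

/-- The starting points are distinct and lie on one level, while all later points lie on higher
levels. Disjointness of the family is therefore disjointness of the tails. -/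
theorem disjointFamilyGF_step {n : ℕ} {P Q : Fin n → ℤ × ℤ} {t : ℤ}
    (ht : ∀ i, (P i).1 - (P i).2 = t) (hP : Function.Injective P) (hPQ : ∀ i, P i ≠ Q i) :
    disjointFamilyGF X Y q P Q = ∑ σ : Fin n → Step,
      (∏ i, stepWeight X Y q (P i) (σ i)) *
        disjointFamilyGF X Y q (fun i => (σ i).move (P i)) Q := by
  let e : (Σ σ : Fin n → Step, ∀ i, LatticePath ((σ i).move (P i)) (Q i)) ≃
      ∀ i, LatticePath (P i) (Q i) :=
    { toFun := fun p i => LatticePath.consEquiv (hPQ i) ⟨p.1 i, p.2 i⟩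
      invFun := fun F => ⟨fun i => ((LatticePath.consEquiv (hPQ i)).symm (F i)).1,
        fun i => ((LatticePath.consEquiv (hPQ i)).symm (F i)).2⟩
      left_inv := fun p => rfl
      right_inv := fun F => by ext1 i; exact (LatticePath.consEquiv (hPQ i)).apply_symm_apply _ }
  simp only [disjointFamilyGF, Finset.mul_sum]
  rw [← Fintype.sum_sigma']
  refine (Fintype.sum_equiv e _ _ fun p => ?_).symm
  have hw : ∏ i, (e p i).weight X Y q =
      (∏ i, stepWeight X Y q (P i) (p.1 i)) * ∏ i, (p.2 i).weight X Y q := by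
    rw [← Finset.prod_mul_distrib]; rfl
  have hd : IsDisjointFamily (e p) ↔ IsDisjointFamily p.2 := by
    have hne : ∀ i j, P i ∉ points ((p.1 j).move (P j)) (p.2 j).1 := by
      intro i j h
      have h1 := eq_or_lt_of_mem_points h
      have h2 := ht i
      have h3 := ht j
      cases hs : p.1 j <;> simp only [hs, Step.move] at h1
      all_goals
        obtain h1 | h1 := h1
        · rw [h1] at h2; simp only at h2; omega
        · omega
    refine forall_congr' fun i => forall_congr' fun j => forall_congr' fun hij => ?_
    change List.Disjoint (P i :: points ((p.1 i).move (P i)) (p.2 i).1)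
      (P j :: points ((p.1 j).move (P j)) (p.2 j).1) ↔ _
    rw [List.disjoint_cons_left, List.disjoint_cons_right, List.mem_cons, not_or]
    exact ⟨fun h => h.2.2, fun h => ⟨⟨hP.ne hij, hne i j⟩, hne j i, h⟩⟩
  by_cases h : IsDisjointFamily p.2
  · rw [if_pos h, if_pos (hd.2 h), hw]
  · rw [if_neg h, if_neg (mt hd.1 h), mul_zero]

theorem disjointFamilyGF_stop {n : ℕ} {P Q : Fin (n + 1) → ℤ × ℤ} {t : ℤ}
    (ht : ∀ i, (P i).1 - (P i).2 = t) (hP : Function.Injective P) (hPQ : P 0 = Q 0) :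
    disjointFamilyGF X Y q P Q =
      disjointFamilyGF X Y q (fun i => P i.succ) fun i => Q i.succ := by
  have : Unique (LatticePath (P 0) (Q 0)) := by rw [← hPQ]; infer_instance
  have h0 : ∀ p : LatticePath (P 0) (Q 0), p.1 = [] := by
    intro p
    have h := p.length_eq
    have h1 := congrArg Prod.fst hPQ
    have h2 := congrArg Prod.snd hPQ
    exact List.length_eq_zero_iff.1 (by omega)
  let e : (∀ i : Fin n, LatticePath (P i.succ) (Q i.succ)) ≃ ∀ i, LatticePath (P i) (Q i) :=
    (Equiv.uniqueProd _ (LatticePath (P 0) (Q 0))).symm.trans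
      (Fin.consEquiv fun i => LatticePath (P i) (Q i))
  refine (Fintype.sum_equiv e _ _ fun F => ?_).symm
  have hs : ∀ i : Fin n, e F i.succ = F i := fun i => rfl
  have hw : ∏ i, (e F i).weight X Y q = ∏ i, (F i).weight X Y q := by
    rw [Fin.prod_univ_succ, LatticePath.weight, h0]
    simp only [walkWeight, one_mul, hs]
  have hd : IsDisjointFamily (e F) ↔ IsDisjointFamily F := by
    have hne : ∀ i : Fin n, P 0 ∉ points (P i.succ) (F i).1 := by
      intro i h
      have h1 := ht 0
      have h2 := ht i.succ
      obtain h | h := eq_or_lt_of_mem_points h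
      · exact (Fin.succ_ne_zero i) (hP h).symm
      · omega
    constructor
    · intro h i j hij
      exact h i.succ j.succ (by simpa using hij)
    · intro h i j hij
      induction i using Fin.cases with
      | zero =>
        induction j using Fin.cases with
        | zero => exact (hij rfl).elim
        | succ j => rw [h0]; simpa [points, hs] using hne j
      | succ i =>
        induction j using Fin.cases with
        | zero => rw [h0]; simpa [points, hs] using hne i
        | succ j => exact h i j (by simpa using hij)
  by_cases h : IsDisjointFamily F
  · rw [if_pos h, if_pos (hd.2 h), hw]
  · rw [if_neg h, if_neg (mt hd.1 h)]

/-- Induction on a bound `m` for the number of levels still to be treated. Colliding steps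
contribute zero on both sides. -/
theorem disjointFamilyGF_eq_det (m : ℕ) {n : ℕ} (t : ℤ) (r c : Fin n → ℤ) (hr : StrictMono r)
    (hc : StrictMono c) (hct : ∀ i, t ≤ c i) (hcm : ∀ i, c i < t + m) :
    disjointFamilyGF X Y q (fun i => levelPoint t (r i)) (fun i => (c i, 0)) =
      (pathMatrix X Y q t r c).det := by
  induction m generalizing n t with
  | zero =>
    have : IsEmpty (Fin n) := ⟨fun i => by have := hct i; have := hcm i; push_cast at *; omega⟩
    rw [Matrix.det_isEmpty, disjointFamilyGF, Fintype.sum_unique,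
      if_pos (show IsDisjointFamily _ from fun i => isEmptyElim i),
      Finset.univ_eq_empty, Finset.prod_empty]
  | succ m ih =>
    have hinj : ∀ {n : ℕ} {r : Fin n → ℤ}, StrictMono r →
        Function.Injective fun i => levelPoint t (r i) :=
      fun hr i j hij => hr.injective (congrArg Prod.fst hij)
    have hlev : ∀ {n : ℕ} (r : Fin n → ℤ) (i : Fin n),
        (levelPoint t (r i)).1 - (levelPoint t (r i)).2 = t :=
      fun r i => by simp [levelPoint]
    have step : ∀ {n : ℕ} (r c : Fin n → ℤ), StrictMono r → StrictMono c → (∀ i, t < c i) →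
        (∀ i, c i < t + (m + 1 : ℕ)) →
        disjointFamilyGF X Y q (fun i => levelPoint t (r i)) (fun i => (c i, 0)) =
          (pathMatrix X Y q t r c).det := by
      intro n r c hr hc hct hcm
      rw [det_pathMatrix_step X Y q r c hct, disjointFamilyGF_step X Y q (hlev r) (hinj hr)
        fun i => levelPoint_ne (hct i)]
      refine Finset.sum_congr rfl fun σ _ => congrArg _ ?_
      by_cases h : Function.Injective fun i => (σ i).advance (r i)
      · simp only [Step.move_levelPoint]
        exact ih (t + 1) _ c ((monotone_advance hr σ).strictMono_of_injective h) hc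
          (fun i => hct i) fun i => by have := hcm i; push_cast at this; omega
      · rw [det_pathMatrix_eq_zero_of_not_injective X Y q h, disjointFamilyGF_eq_zero]
        simp only [Step.move_levelPoint]
        exact fun h' => h fun i j hij => h' (by simp only at hij ⊢; rw [hij])
    obtain _ | n := n
    · exact step r c hr hc (fun i => i.elim0) fun i => i.elim0
    -- Only the smallest end point can lie on level `t`. Once its path is removed, all ends lie
    -- beyond `t` and `step` applies on the same level. If `r 0` differs from `t`, no such path
    -- exists, and the determinant has a zero row or a zero column.
    obtain h0 | h0 := (hct 0).eq_or_lt
    · have hlt : ∀ i : Fin n, t < c i.succ := fun i => h0 ▸ hc (Fin.succ_pos i)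
      by_cases hr0 : r 0 = t
      · rw [disjointFamilyGF_stop X Y q (hlev r) (hinj hr) (by simp [levelPoint, hr0, ← h0]),
          det_pathMatrix_stop X Y q hr hr0 h0.symm]
        exact step _ _ (hr.comp (Fin.strictMono_succ)) (hc.comp (Fin.strictMono_succ)) hlt
          fun i => hcm _
      · have hemp : IsEmpty (LatticePath (levelPoint t (r 0)) (c 0, 0)) :=
          isEmpty_latticePath (by simp only [levelPoint]; omega)
        rw [disjointFamilyGF, Finset.sum_eq_zero fun F _ => (hemp.false (F 0)).elim]
        obtain hr0 | hr0 := lt_or_gt_of_ne hr0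
        · rw [det_pathMatrix_eq_zero_of_row X Y q 0 (Or.inl hr0)]
        · rw [det_pathMatrix_eq_zero_of_column X Y q 0 h0.symm]
          exact fun i => (hr0.trans_le (hr.monotone (Fin.zero_le i))).ne'
    · exact step r c hr hc (fun i => h0.trans_le (hc.monotone (Fin.zero_le i))) hcm

end PathMatrix


/-! ### Tilings with a prescribed part -/

theorem Lozenge.mem_cells {l : Lozenge} {t : Triangle} :
    t ∈ l.cells ↔ t = l.upper ∨ t = l.partner := by
  simp [Lozenge.cells]

theorem IsTiling.eq_of_mem_cells {R : Finset Triangle} {T : Finset Lozenge} (hT : IsTiling R T)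
    {l m : Lozenge} (hl : l ∈ T) (hm : m ∈ T) {t : Triangle} (htl : t ∈ l.cells)
    (htm : t ∈ m.cells) : l = m :=
  (hT.2 t (hT.1 l hl htl)).unique ⟨hl, htl⟩ ⟨hm, htm⟩

theorem IsTiling.union {R R' : Finset Triangle} {L T : Finset Lozenge} (hR : R' ⊆ R)
    (hL : IsTiling (R \ R') L) (hT : IsTiling R' T) : IsTiling R (L ∪ T) := by
  refine ⟨fun l hl => ?_, fun t ht => ?_⟩
  · obtain h | h := Finset.mem_union.1 hl
    · exact (hL.1 l h).trans Finset.sdiff_subset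
    · exact (hT.1 l h).trans hR
  · by_cases h : t ∈ R'
    · obtain ⟨l, ⟨hl, htl⟩, hu⟩ := hT.2 t h
      refine ⟨l, ⟨Finset.mem_union_right _ hl, htl⟩, fun m ⟨hm, htm⟩ => ?_⟩
      obtain hm | hm := Finset.mem_union.1 hm
      · exact absurd h (Finset.mem_sdiff.1 (hL.1 m hm htm)).2
      · exact hu m ⟨hm, htm⟩
    · obtain ⟨l, ⟨hl, htl⟩, hu⟩ := hL.2 t (Finset.mem_sdiff.2 ⟨ht, h⟩)
      refine ⟨l, ⟨Finset.mem_union_left _ hl, htl⟩, fun m ⟨hm, htm⟩ => ?_⟩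
      obtain hm | hm := Finset.mem_union.1 hm
      · exact hu m ⟨hm, htm⟩
      · exact absurd (hT.1 m hm htm) h

theorem IsTiling.disjoint {R R' : Finset Triangle} {L T : Finset Lozenge}
    (hL : IsTiling (R \ R') L) (hT : IsTiling R' T) : Disjoint L T := by
  refine Finset.disjoint_left.2 fun l hl hl' => ?_
  have h : l.upper ∈ l.cells := Lozenge.mem_cells.2 (Or.inl rfl)
  exact (Finset.mem_sdiff.1 (hL.1 l hl h)).2 (hT.1 l hl' h)

theorem IsTiling.sdiff {R R' : Finset Triangle} {L T : Finset Lozenge} (hR : R' ⊆ R)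
    (hL : IsTiling (R \ R') L) (hT : IsTiling R T) (hLT : L ⊆ T) : IsTiling R' (T \ L) := by
  refine ⟨fun l hl t ht => ?_, fun t ht => ?_⟩
  · obtain ⟨hl, hl'⟩ := Finset.mem_sdiff.1 hl
    by_contra h
    obtain ⟨m, ⟨hm, htm⟩, -⟩ := hL.2 t (Finset.mem_sdiff.2 ⟨hT.1 l hl ht, h⟩)
    exact hl' (hT.eq_of_mem_cells hl (hLT hm) ht htm ▸ hm)
  · obtain ⟨l, ⟨hl, htl⟩, hu⟩ := hT.2 t (hR ht)
    refine ⟨l, ⟨Finset.mem_sdiff.2 ⟨hl, fun h => ?_⟩, htl⟩,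
      fun m ⟨hm, htm⟩ => hu m ⟨(Finset.mem_sdiff.1 hm).1, htm⟩⟩
    exact (Finset.mem_sdiff.1 (hL.1 l h htl)).2 ht

/-- Adding and removing `L` are inverse bijections between the tilings of `R'` and the tilings of
`R` that contain `L`. -/
theorem sum_tilings_superset {K : Type*} [Field K] (w : Lozenge → K) {R R' : Finset Triangle}
    {L : Finset Lozenge} (hR : R' ⊆ R) (hL : IsTiling (R \ R') L) :
    (∑ T : Tiling R, if L ⊆ T.1 then ∏ l ∈ T.1, w l else 0) =
      (∏ l ∈ L, w l) * ∑ T : Tiling R', ∏ l ∈ T.1, w l := by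
  rw [← Finset.sum_filter, Finset.mul_sum]
  refine (Finset.sum_bij' (fun T _ => ⟨L ∪ T.1, hL.union hR T.2⟩)
    (fun T hT => ⟨T.1 \ L, hL.sdiff hR T.2 (Finset.mem_filter.1 hT).2⟩) ?_ ?_ ?_ ?_ ?_).symm
  · intro T _
    exact Finset.mem_filter.2 ⟨Finset.mem_univ _, Finset.subset_union_left⟩
  · intro T _
    exact Finset.mem_univ _
  · intro T _
    exact Subtype.ext (Finset.union_sdiff_cancel_left (hL.disjoint T.2))
  · intro T hT
    exact Subtype.ext (Finset.union_sdiff_of_subset (Finset.mem_filter.1 hT).2)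
  · intro T _
    exact (Finset.prod_union (hL.disjoint T.2)).symm

theorem tilingGF_empty {K : Type*} [Field K] (X Y q : K) : tilingGF X Y q ∅ = 1 := by
  have h : ∀ T : Tiling ∅, T.1 = ∅ := fun T => Finset.eq_empty_of_forall_notMem fun l hl =>
    Finset.notMem_empty _ (T.2.1 l hl (Lozenge.mem_cells.2 (Or.inl rfl)))
  have : Unique (Tiling ∅) :=
    { default := ⟨∅, by simp [IsTiling]⟩
      uniq := fun T => Subtype.ext (h T) }
  rw [tilingGF, Fintype.sum_unique, h, Finset.prod_empty]

/-! ### Regions that remain after the removal of diagonal strips -/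

theorem up_mem_halfHexagon {x N : ℕ} {r s : ℤ} :
    Triangle.up r s ∈ halfHexagon x N ↔ (x : ℤ) ≤ r ∧ r < x + N ∧ 0 ≤ s ∧ s ≤ r := by
  simp only [halfHexagon, Finset.mem_biUnion, Finset.mem_Ico, Finset.mem_union, Finset.mem_image,
    Finset.mem_range, Triangle.up.injEq, reduceCtorEq, and_false, exists_false, or_false]
  constructor
  · rintro ⟨r', h, s', h', rfl, rfl⟩
    omega
  · intro h
    exact ⟨r.toNat, by omega, s.toNat, by omega, by omega, by omega⟩

theorem down_mem_halfHexagon {x N : ℕ} {r s : ℤ} :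
    Triangle.down r s ∈ halfHexagon x N ↔ (x : ℤ) ≤ r ∧ r < x + N ∧ 0 ≤ s ∧ s < r := by
  simp only [halfHexagon, Finset.mem_biUnion, Finset.mem_Ico, Finset.mem_union, Finset.mem_image,
    Finset.mem_range, Triangle.down.injEq, reduceCtorEq, and_false, exists_false, false_or]
  constructor
  · rintro ⟨r', h, s', h', rfl, rfl⟩
    omega
  · intro h
    exact ⟨r.toNat, by omega, s.toNat, by omega, by omega, by omega⟩

/-- The conditions on the triangles of a half hexagon that remain after the removal of diagonal
strips: they lie in the strips from `t` on, they are not dents on the right in one of the rows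
`c_j`, and those of the strip `t` that point upwards lie in the rows `r_i`. -/
def Triangle.Remains (t : ℤ) {n : ℕ} (r c : Fin n → ℤ) : Triangle → Prop
  | Triangle.up ρ s => t ≤ s ∧ (s = t → ∃ i, r i = ρ) ∧ (ρ = s → ∀ j, c j ≠ ρ)
  | Triangle.down _ s => t ≤ s

open Classical in
/-- The region that remains of a half hexagon after the removal of the diagonal strips before `t`
and of the part of the strip `t` that is covered together with them. -/
def stripRegion (x N : ℕ) (t : ℤ) {n : ℕ} (r c : Fin n → ℤ) : Finset Triangle :=
  (halfHexagon x N).filter fun T => T.Remains t r c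

section StripRegion

variable {x N : ℕ} {t : ℤ} {n : ℕ} {r c : Fin n → ℤ}

theorem up_mem_stripRegion {ρ s : ℤ} : Triangle.up ρ s ∈ stripRegion x N t r c ↔
    ((x : ℤ) ≤ ρ ∧ ρ < x + N ∧ 0 ≤ s ∧ s ≤ ρ) ∧
      t ≤ s ∧ (s = t → ∃ i, r i = ρ) ∧ (ρ = s → ∀ j, c j ≠ ρ) := by
  classical
  rw [stripRegion, Finset.mem_filter, up_mem_halfHexagon, Triangle.Remains]

theorem down_mem_stripRegion {ρ s : ℤ} : Triangle.down ρ s ∈ stripRegion x N t r c ↔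
    ((x : ℤ) ≤ ρ ∧ ρ < x + N ∧ 0 ≤ s ∧ s < ρ) ∧ t ≤ s := by
  classical
  rw [stripRegion, Finset.mem_filter, down_mem_halfHexagon, Triangle.Remains]

theorem dentedRegion_eq_stripRegion (x N : ℕ) {n : ℕ} (a c : Fin n → ℕ) :
    dentedRegion x N a c = stripRegion x N 0 (fun i => (a i : ℤ)) fun i => (c i : ℤ) := by
  ext T
  simp only [dentedRegion, dentedHalfHexagon, Finset.mem_sdiff, Finset.mem_image, Finset.mem_Ico,
    Finset.mem_univ, true_and]
  cases T with
  | up ρ s =>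
    rw [up_mem_stripRegion, up_mem_halfHexagon]
    simp only [Triangle.up.injEq]
    constructor
    · rintro ⟨⟨h1, h2⟩, h3⟩
      refine ⟨h1, h1.2.2.1, fun hs => ?_, fun hs j hj => h3 ⟨c j, ⟨j, rfl⟩, hj, by omega⟩⟩
      by_contra h
      refine h2 ⟨ρ.toNat, ⟨by omega, fun ⟨i, hi⟩ => h ⟨i, by omega⟩⟩, by omega, by omega⟩
    · rintro ⟨h1, -, h2, h3⟩
      refine ⟨⟨h1, ?_⟩, ?_⟩
      · rintro ⟨m, ⟨-, hm⟩, rfl, rfl⟩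
        obtain ⟨i, hi⟩ := h2 rfl
        exact hm ⟨i, by exact_mod_cast hi⟩
      · rintro ⟨m, ⟨j, rfl⟩, rfl, rfl⟩
        exact h3 rfl j rfl
  | down ρ s =>
    rw [down_mem_stripRegion, down_mem_halfHexagon]
    simp only [reduceCtorEq, and_false, exists_false, not_false_eq_true, and_true]
    tauto

/-- The triangle `up t t` is missing either way: as a right dent before, and afterwards because `t`
is no longer among the rows. -/
theorem stripRegion_stop {r c : Fin (n + 1) → ℤ} (hr : r 0 = t) (hc : c 0 = t)
    (h0 : ∀ i : Fin n, t < r i.succ) :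
    stripRegion x N t r c = stripRegion x N t (fun i => r i.succ) fun i => c i.succ := by
  ext T
  cases T with
  | up ρ s =>
    rw [up_mem_stripRegion, up_mem_stripRegion]
    refine and_congr_right fun h => and_congr_right fun h1 => ?_
    rw [Fin.exists_fin_succ, Fin.forall_fin_succ, hr, hc]
    constructor
    · rintro ⟨h2, h3⟩
      exact ⟨fun h4 => (h2 h4).resolve_left fun h5 => (h3 (by omega)).1 h5, fun h4 => (h3 h4).2⟩
    · rintro ⟨h2, h3⟩
      refine ⟨fun h4 => Or.inr (h2 h4), fun h4 => ⟨fun h5 => ?_, h3 h4⟩⟩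
      obtain ⟨i, hi⟩ := h2 (by omega)
      have := h0 i
      omega
  | down ρ s => rw [down_mem_stripRegion, down_mem_stripRegion]

/-! ### Tilings of one diagonal strip and the recursion -/

/-- The shape of the lozenge that corresponds to a step. -/
def Step.shape : Step → Shape
  | Step.right => Shape.vertical
  | Step.down => Shape.rightTilted

/-- The lozenge that corresponds to a step of a path from the line `x - y = t`. -/
def stepLozenge (t r : ℤ) (s : Step) : Lozenge := ⟨s.shape, r, t⟩

theorem stepLozenge_partner (t r : ℤ) (s : Step) :
    (stepLozenge t r s).partner = Triangle.down (s.advance r) t := by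
  cases s <;> rfl

theorem stepLozenge_upper (t r : ℤ) (s : Step) :
    (stepLozenge t r s).upper = Triangle.up r t := rfl

/-- The left-tilted lozenge that covers the triangle `down ρ t`. -/
def fillLozenge (t ρ : ℤ) : Lozenge := ⟨Shape.leftTilted, ρ, t + 1⟩

theorem fillLozenge_partner (t ρ : ℤ) : (fillLozenge t ρ).partner = Triangle.down ρ t := by
  simp [fillLozenge, Lozenge.partner]

theorem fillLozenge_upper (t ρ : ℤ) : (fillLozenge t ρ).upper = Triangle.up ρ (t + 1) := rfl

open Classical in
/-- The lozenges that cover the strip `t` when the paths perform the steps `σ`. -/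
def stripLozenges (x N : ℕ) (t : ℤ) {n : ℕ} (r : Fin n → ℤ) (σ : Fin n → Step) :
    Finset Lozenge :=
  (Finset.univ.image fun i => stepLozenge t (r i) (σ i)) ∪
    ((Finset.Ico (max (x : ℤ) (t + 1)) (x + N)).filter
      fun ρ => ∀ i, (σ i).advance (r i) ≠ ρ).image (fillLozenge t)

theorem mem_stripLozenges {σ : Fin n → Step} {l : Lozenge} : l ∈ stripLozenges x N t r σ ↔
    (∃ i, stepLozenge t (r i) (σ i) = l) ∨
      ∃ ρ : ℤ, ((x : ℤ) ≤ ρ ∧ t < ρ ∧ ρ < x + N ∧ ∀ i, (σ i).advance (r i) ≠ ρ) ∧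
        fillLozenge t ρ = l := by
  simp only [stripLozenges, Finset.mem_union, Finset.mem_image, Finset.mem_univ, true_and,
    Finset.mem_filter, Finset.mem_Ico, max_le_iff, Int.add_one_le_iff, and_assoc]

/-- A right step from $(r,r-t)$ has label $r-2(r-t)=2t-r$, which is the label of the vertical
lozenge in row $r$ and position $t$. All other lozenges and steps weigh 1. -/
theorem prod_stripLozenges {K : Type*} [Field K] (X Y q : K) (hr : Function.Injective r)
    (σ : Fin n → Step) :
    ∏ l ∈ stripLozenges x N t r σ, l.weight X Y q = stepsWeight X Y q t r σ := by
  classical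
  rw [stripLozenges, Finset.prod_union, Finset.prod_image,
    Finset.prod_eq_one (s := Finset.image _ _), mul_one]
  · refine Finset.prod_congr rfl fun i _ => ?_
    cases hs : σ i
    · simp only [stepLozenge, Step.shape, Lozenge.weight, stepWeight, levelPoint]
      congr 1; ring
    · rfl
  · intro l hl
    obtain ⟨ρ, -, rfl⟩ := Finset.mem_image.1 hl
    rfl
  · intro i _ j _ h
    exact hr (congrArg Lozenge.row h)
  · refine Finset.disjoint_left.2 fun l h h' => ?_
    obtain ⟨i, -, rfl⟩ := Finset.mem_image.1 h
    obtain ⟨ρ, -, h⟩ := Finset.mem_image.1 h'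
    have := congrArg Lozenge.pos h
    simp [fillLozenge, stepLozenge] at this

/-- The steps lead to distinct points, remain inside of the half hexagon, and reach the right
dent that adjoins the strip `t + 1` if there is one. -/
def ValidSteps (x N : ℕ) (t : ℤ) {n : ℕ} (r c : Fin n → ℤ) (σ : Fin n → Step) : Prop :=
  (Function.Injective fun i => (σ i).advance (r i)) ∧
    (∀ i, t < (σ i).advance (r i) ∧ (σ i).advance (r i) < x + N) ∧
      ∀ j, c j = t + 1 → ∃ i, (σ i).advance (r i) = t + 1

theorem stripRegion_subset {r' : Fin n → ℤ} :
    stripRegion x N (t + 1) r' c ⊆ stripRegion x N t r c := by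
  intro T hT
  cases T with
  | up ρ s =>
    rw [up_mem_stripRegion] at hT ⊢
    exact ⟨hT.1, by omega, by omega, hT.2.2.2⟩
  | down ρ s =>
    rw [down_mem_stripRegion] at hT ⊢
    exact ⟨hT.1, by omega⟩

/-- The conditions on the rows of starting points and right dents. -/
structure Admissible (x N : ℕ) (t : ℤ) {n : ℕ} (r c : Fin n → ℤ) : Prop where
  nonneg : 0 ≤ t
  strictMono : StrictMono r
  strictMono' : StrictMono c
  le_row : ∀ i, (x : ℤ) ≤ r i
  level_le_row : ∀ i, t ≤ r i
  row_lt : ∀ i, r i < x + N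
  le_dent : ∀ j, (x : ℤ) ≤ c j
  dent_lt : ∀ j, c j < x + N

theorem isTiling_stripLozenges (h : Admissible x N t r c) (hc : ∀ j, t < c j)
    {σ : Fin n → Step} (hσ : ValidSteps x N t r c σ) :
    IsTiling (stripRegion x N t r c \
      stripRegion x N (t + 1) (fun i => (σ i).advance (r i)) c) (stripLozenges x N t r σ) := by
  have h0 := h.nonneg
  obtain ⟨hinj, hran, hdent⟩ := hσ
  constructor
  · intro l hl T hT
    rw [Lozenge.mem_cells] at hT
    obtain ⟨i, rfl⟩ | ⟨ρ, ⟨h1, h2, h3, h4⟩, rfl⟩ := mem_stripLozenges.1 hl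
    · have h1 := h.le_row i
      have h2 := h.level_le_row i
      have h3 := h.row_lt i
      have h4 := hran i
      have h5 := (σ i).le_advance (r i)
      rw [stepLozenge_upper, stepLozenge_partner] at hT
      obtain rfl | rfl := hT
      · rw [Finset.mem_sdiff, up_mem_stripRegion, up_mem_stripRegion]
        refine ⟨⟨by omega, le_rfl, fun _ => ⟨i, rfl⟩, fun h6 j => ?_⟩, by omega⟩
        have := hc j
        omega
      · rw [Finset.mem_sdiff, down_mem_stripRegion, down_mem_stripRegion]
        omega
    · rw [fillLozenge_upper, fillLozenge_partner] at hT
      obtain rfl | rfl := hT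
      · rw [Finset.mem_sdiff, up_mem_stripRegion, up_mem_stripRegion]
        refine ⟨⟨by omega, by omega, by omega, fun h6 j h7 => ?_⟩, fun h6 => ?_⟩
        · obtain ⟨i, hi⟩ := hdent j (by omega)
          exact h4 i (by omega)
        · obtain ⟨i, hi⟩ := h6.2.2.1 rfl
          exact h4 i hi
      · rw [Finset.mem_sdiff, down_mem_stripRegion, down_mem_stripRegion]
        omega
  · intro T hT
    rw [Finset.mem_sdiff] at hT
    simp only [mem_stripLozenges, Lozenge.mem_cells]
    cases T with
    | up ρ s =>
      rw [up_mem_stripRegion, up_mem_stripRegion] at hT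
      obtain ⟨⟨h1, h2, h3, h4⟩, h5⟩ := hT
      obtain rfl | h6 := h2.eq_or_lt
      · obtain ⟨i, rfl⟩ := h3 rfl
        refine ⟨_, ⟨Or.inl ⟨i, rfl⟩, Or.inl rfl⟩, ?_⟩
        rintro _ ⟨⟨j, rfl⟩ | ⟨ρ, -, rfl⟩, h7⟩
        · rw [stepLozenge_upper, stepLozenge_partner] at h7
          simp only [Triangle.up.injEq, and_true, reduceCtorEq, or_false] at h7
          rw [h.strictMono.injective h7]
        · rw [fillLozenge_upper, fillLozenge_partner] at h7
          simp at h7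
      · have h7 : s = t + 1 ∧ ∀ i, (σ i).advance (r i) ≠ ρ := by
          by_contra h8
          refine h5 ⟨h1, h6, fun h9 => ?_, h4⟩
          by_contra h10
          exact h8 ⟨h9, fun i hi => h10 ⟨i, hi⟩⟩
        obtain ⟨rfl, h7⟩ := h7
        refine ⟨_, ⟨Or.inr ⟨ρ, ⟨h1.1, by omega, h1.2.1, h7⟩, rfl⟩, Or.inl rfl⟩, ?_⟩
        rintro _ ⟨⟨j, rfl⟩ | ⟨ρ', -, rfl⟩, h8⟩
        · rw [stepLozenge_upper, stepLozenge_partner] at h8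
          simp at h8
        · rw [fillLozenge_upper, fillLozenge_partner] at h8
          simp only [Triangle.up.injEq, and_true, reduceCtorEq, or_false] at h8
          rw [h8]
    | down ρ s =>
      rw [down_mem_stripRegion, down_mem_stripRegion] at hT
      obtain rfl : s = t := by omega
      by_cases h1 : ∃ i, (σ i).advance (r i) = ρ
      · obtain ⟨i, rfl⟩ := h1
        refine ⟨_, ⟨Or.inl ⟨i, rfl⟩, Or.inr (stepLozenge_partner _ _ _).symm⟩, ?_⟩
        rintro _ ⟨⟨j, rfl⟩ | ⟨ρ, h6, rfl⟩, h7⟩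
        · rw [stepLozenge_upper, stepLozenge_partner] at h7
          simp only [Triangle.down.injEq, and_true, reduceCtorEq, false_or] at h7
          rw [hinj h7]
        · rw [fillLozenge_upper, fillLozenge_partner] at h7
          simp only [Triangle.down.injEq, and_true, reduceCtorEq, false_or] at h7
          exact absurd h7 (h6.2.2.2 i)
      · push Not at h1
        refine ⟨_, ⟨Or.inr ⟨ρ, ⟨by omega, by omega, by omega, h1⟩, rfl⟩,
          Or.inr (fillLozenge_partner _ _).symm⟩, ?_⟩
        rintro _ ⟨⟨j, rfl⟩ | ⟨ρ', -, rfl⟩, h8⟩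
        · rw [stepLozenge_upper, stepLozenge_partner] at h8
          simp only [Triangle.down.injEq, and_true, reduceCtorEq, false_or] at h8
          exact absurd h8.symm (h1 j)
        · rw [fillLozenge_upper, fillLozenge_partner] at h8
          simp only [Triangle.down.injEq, and_true, reduceCtorEq, false_or] at h8
          rw [h8]

/-- The lozenge over each `up (r i) t` is forced to be a step, and the remaining `down ρ t` can then
be covered only by left-tilted lozenges. The form of the conclusion collapses a sum over all `σ` to
the single term `τ`. -/
theorem exists_validSteps_and_subset_iff (h : Admissible x N t r c) (hc : ∀ j, t < c j)
    {T : Finset Lozenge} (hT : IsTiling (stripRegion x N t r c) T) :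
    ∃ τ : Fin n → Step, ∀ σ : Fin n → Step,
      (ValidSteps x N t r c σ ∧ stripLozenges x N t r σ ⊆ T) ↔ σ = τ := by
  have h0 := h.nonneg
  have hup : ∀ i, Triangle.up (r i) t ∈ stripRegion x N t r c := fun i => by
    rw [up_mem_stripRegion]
    refine ⟨⟨h.le_row i, h.row_lt i, h0, h.level_le_row i⟩, le_rfl, fun _ => ⟨i, rfl⟩,
      fun h1 j => ?_⟩
    have := hc j
    omega
  have hshape : ∀ l ∈ T, ∀ i, l.row = r i → l.pos = t → ∃ s, l = stepLozenge t (r i) s := by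
    rintro ⟨shape, row, pos⟩ hl i h1 h2
    simp only at h1 h2
    subst h1 h2
    cases shape
    · exact ⟨Step.right, rfl⟩
    · exact ⟨Step.down, rfl⟩
    -- A left-tilted lozenge here would need a downward triangle of strip `t - 1`, which has been
    -- removed.
    · have h3 := hT.1 _ hl (Lozenge.mem_cells.2 (Or.inr rfl))
      simp only [Lozenge.partner] at h3
      rw [down_mem_stripRegion] at h3
      omega
  have hex : ∀ i, ∃ s, stepLozenge t (r i) s ∈ T := fun i => by
    obtain ⟨l, ⟨hl, htl⟩, -⟩ := hT.2 _ (hup i)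
    have h1 : l.row = r i ∧ l.pos = t := by
      obtain h1 | h1 := Lozenge.mem_cells.1 htl
      · simp only [Lozenge.upper, Triangle.up.injEq] at h1
        exact ⟨h1.1.symm, h1.2.symm⟩
      · cases hs : l.shape <;> simp [Lozenge.partner, hs] at h1
    obtain ⟨s, rfl⟩ := hshape l hl i h1.1 h1.2
    exact ⟨s, hl⟩
  choose τ hτ using hex
  have hdown : ∀ i, Triangle.down ((τ i).advance (r i)) t ∈ (stepLozenge t (r i) (τ i)).cells :=
    fun i => Lozenge.mem_cells.2 (Or.inr (stepLozenge_partner _ _ _).symm)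
  have hfill : ∀ ρ : ℤ, (x : ℤ) ≤ ρ → t < ρ → ρ < x + N → (∀ i, (τ i).advance (r i) ≠ ρ) →
      fillLozenge t ρ ∈ T := by
    intro ρ h1 h2 h3 h4
    obtain ⟨l, ⟨hl, htl⟩, -⟩ := hT.2 (Triangle.down ρ t) (by rw [down_mem_stripRegion]; omega)
    have h5 := hT.1 l hl (Lozenge.mem_cells.2 (Or.inl rfl))
    obtain ⟨shape, row, pos⟩ := l
    rw [Lozenge.upper, up_mem_stripRegion] at h5
    simp only at h5
    obtain h6 | h6 := Lozenge.mem_cells.1 htl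
    · simp [Lozenge.upper] at h6
    have key : ∀ s : Step, (⟨shape, row, pos⟩ : Lozenge) = stepLozenge t row s → False := by
      intro s hs
      have h7 : pos = t := congrArg Lozenge.pos hs
      obtain ⟨i, hi⟩ := h5.2.2.1 h7
      rw [hs, stepLozenge_partner] at h6
      simp only [Triangle.down.injEq, and_true] at h6
      rw [hs, ← hi] at hl
      have h8 : stepLozenge t (r i) s = stepLozenge t (r i) (τ i) :=
        hT.eq_of_mem_cells hl (hτ i) (Lozenge.mem_cells.2 (Or.inl rfl))
          (Lozenge.mem_cells.2 (Or.inl rfl))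
      have h9 := congrArg Lozenge.partner h8
      rw [stepLozenge_partner, stepLozenge_partner] at h9
      simp only [Triangle.down.injEq, and_true] at h9
      exact h4 i (by rw [← h9, hi, h6])
    cases shape
    · simp only [Lozenge.partner, Triangle.down.injEq] at h6
      exact (key Step.right (by rw [h6.2]; rfl)).elim
    · simp only [Lozenge.partner, Triangle.down.injEq] at h6
      exact (key Step.down (by rw [h6.2]; rfl)).elim
    · simp only [Lozenge.partner, Triangle.down.injEq] at h6
      obtain ⟨rfl, rfl⟩ := h6
      simpa [fillLozenge] using hl
  refine ⟨τ, fun σ => ⟨fun hσ => funext fun i => ?_, ?_⟩⟩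
  · have h1 : stepLozenge t (r i) (σ i) ∈ T :=
      hσ.2 (mem_stripLozenges.2 (Or.inl ⟨i, rfl⟩))
    have h2 : stepLozenge t (r i) (σ i) = stepLozenge t (r i) (τ i) :=
      hT.eq_of_mem_cells h1 (hτ i) (Lozenge.mem_cells.2 (Or.inl rfl))
        (Lozenge.mem_cells.2 (Or.inl rfl))
    have h3 := congrArg Lozenge.shape h2
    cases hs : σ i <;> cases ht : τ i <;> simp_all [stepLozenge, Step.shape]
  · rintro rfl
    refine ⟨⟨fun i j hij => ?_, fun i => ?_, fun j hj => ?_⟩, fun l hl => ?_⟩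
    · have h1 := hT.eq_of_mem_cells (hτ i) (hτ j) (hdown i) (by
        simp only at hij
        rw [hij]
        exact hdown j)
      exact h.strictMono.injective (congrArg Lozenge.row h1)
    · have h1 := hT.1 _ (hτ i) (hdown i)
      rw [down_mem_stripRegion] at h1
      omega
    -- If no path reached the dent, a fill lozenge would cover the missing triangle `up (t + 1) (t +
    -- 1)`.
    · by_contra h1
      push Not at h1
      have h2 := h.le_dent j
      have h3 := h.dent_lt j
      have h4 := hT.1 _ (hfill (t + 1) (by omega) (by omega) (by omega) h1)
        (Lozenge.mem_cells.2 (Or.inl rfl))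
      rw [fillLozenge_upper, up_mem_stripRegion] at h4
      exact h4.2.2.2 rfl j hj
    · obtain ⟨i, rfl⟩ | ⟨ρ, ⟨h1, h2, h3, h4⟩, rfl⟩ := mem_stripLozenges.1 hl
      · exact hτ i
      · exact hfill ρ h1 h2 h3 h4

open Classical in
theorem tilingGF_stripRegion_step {K : Type*} [Field K] (X Y q : K) (h : Admissible x N t r c)
    (hc : ∀ j, t < c j) :
    tilingGF X Y q (stripRegion x N t r c) = ∑ σ : Fin n → Step, if ValidSteps x N t r c σ then
      stepsWeight X Y q t r σ *
        tilingGF X Y q (stripRegion x N (t + 1) (fun i => (σ i).advance (r i)) c) else 0 := by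
  have h1 : ∀ T : Tiling (stripRegion x N t r c), ∏ l ∈ T.1, l.weight X Y q =
      ∑ σ : Fin n → Step, if ValidSteps x N t r c σ ∧ stripLozenges x N t r σ ⊆ T.1 then
        ∏ l ∈ T.1, l.weight X Y q else 0 := by
    intro T
    obtain ⟨τ, hτ⟩ := exists_validSteps_and_subset_iff h hc T.2
    simp only [hτ, Finset.sum_ite_eq', Finset.mem_univ, if_true]
  rw [tilingGF, Finset.sum_congr rfl fun T _ => h1 T, Finset.sum_comm]
  refine Finset.sum_congr rfl fun σ _ => ?_
  by_cases hσ : ValidSteps x N t r c σ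
  · simp only [hσ, true_and, if_true]
    rw [sum_tilings_superset _ stripRegion_subset (isTiling_stripLozenges h hc hσ),
      prod_stripLozenges X Y q h.strictMono.injective, tilingGF]
  · simp only [hσ, false_and, if_false, Finset.sum_const_zero]

/-- Both sides obey the same recursion over the strips. `hcr` is needed because `up t t` can be
absent without being a dent, so the region may not see a dent at level `t`, whereas an unreached end
point makes the determinant vanish. -/
theorem tilingGF_stripRegion_eq_det {K : Type*} [Field K] (X Y q : K) (m : ℕ) {n : ℕ} {t : ℤ}
    {r c : Fin n → ℤ} (h : Admissible x N t r c) (hct : ∀ j, t ≤ c j)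
    (hcr : ∀ j, c j = t → ∃ i, r i = t) (hm : (x + N : ℤ) ≤ t + m) :
    tilingGF X Y q (stripRegion x N t r c) = (pathMatrix X Y q t r c).det := by
  classical
  induction m generalizing n t with
  | zero =>
    have : IsEmpty (Fin n) :=
      ⟨fun i => by have := hct i; have := h.dent_lt i; push_cast at *; omega⟩
    have h1 : stripRegion x N t r c = ∅ := by
      refine Finset.eq_empty_of_forall_notMem fun T hT => ?_
      push_cast at hm
      cases T with
      | up ρ s => rw [up_mem_stripRegion] at hT; omega
      | down ρ s => rw [down_mem_stripRegion] at hT; omega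
    rw [h1, tilingGF_empty, Matrix.det_isEmpty]
  | succ m ih =>
    have step : ∀ {n : ℕ} {r c : Fin n → ℤ}, Admissible x N t r c → (∀ j, t < c j) →
        tilingGF X Y q (stripRegion x N t r c) = (pathMatrix X Y q t r c).det := by
      intro n r c h hct
      rw [det_pathMatrix_step X Y q r c hct, tilingGF_stripRegion_step X Y q h hct]
      refine Finset.sum_congr rfl fun σ _ => ?_
      split_ifs with hσ
      · congr 1
        refine ih ⟨?_, ?_, h.strictMono', ?_, ?_, ?_, h.le_dent, h.dent_lt⟩ hct hσ.2.2 ?_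
        · have := h.nonneg; omega
        · exact (monotone_advance h.strictMono σ).strictMono_of_injective hσ.1
        · exact fun i => (h.le_row i).trans ((σ i).le_advance _)
        · exact fun i => (hσ.2.1 i).1
        · exact fun i => (hσ.2.1 i).2
        · push_cast at hm; omega
      · symm
        refine mul_eq_zero_of_right _ ?_
        -- Each way in which validity can fail kills the determinant: equal rows, a start below the
        -- axis, a start beyond every end point, or an end point that no path reaches.
        by_contra hD
        refine hσ ⟨?_, fun i => ⟨?_, ?_⟩, fun j hj => ?_⟩
        · by_contra h1
          exact hD (det_pathMatrix_eq_zero_of_not_injective X Y q h1)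
        · by_contra h1
          exact hD (det_pathMatrix_eq_zero_of_row X Y q i (Or.inl (by omega)))
        · by_contra h1
          refine hD (det_pathMatrix_eq_zero_of_row X Y q i (Or.inr fun j => ?_))
          have := h.dent_lt j
          omega
        · by_contra h1
          push Not at h1
          exact hD (det_pathMatrix_eq_zero_of_column X Y q j hj h1)
    obtain _ | n := n
    · exact step h fun i => i.elim0
    obtain h0 | h0 := (hct 0).eq_or_lt
    · obtain ⟨i, hi⟩ := hcr 0 h0.symm
      have hr0 : r 0 = t :=
        le_antisymm (hi ▸ h.strictMono.monotone (Fin.zero_le i)) (h.level_le_row 0)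
      rw [stripRegion_stop hr0 h0.symm fun i => hr0 ▸ h.strictMono (Fin.succ_pos i),
        det_pathMatrix_stop X Y q h.strictMono hr0 h0.symm]
      exact step ⟨h.nonneg, h.strictMono.comp Fin.strictMono_succ,
        h.strictMono'.comp Fin.strictMono_succ, fun i => h.le_row _, fun i => h.level_le_row _,
        fun i => h.row_lt _, fun i => h.le_dent _, fun i => h.dent_lt _⟩
        fun i => h0 ▸ h.strictMono' (Fin.succ_pos i)
    · exact step h fun i => h0.trans_le (h.strictMono'.monotone (Fin.zero_le i))

end StripRegion

theorem gfMatrix_eq_pathMatrix {K : Type*} [Field K] (X Y q : K) {n : ℕ} (a c : Fin n → ℕ) :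
    gfMatrix X Y q a c = pathMatrix X Y q 0 (fun i => (a i : ℤ)) fun i => (c i : ℤ) := by
  ext i j
  change pathGF X Y q _ _ = pathGF X Y q _ _
  simp only [levelPoint, sub_zero]

theorem tilingGF_eq_det {K : Type*} [Field K] (X Y q : K) {n : ℕ} {a c : Fin n → ℕ}
    (ha : StrictMono a) (hc : StrictMono c) (hac : ∀ i, a i ≤ c i) {x N : ℕ}
    (hx : ∀ i, x ≤ a i) (hN : ∀ i, c i < x + N) :
    tilingGF X Y q (dentedRegion x N a c) = (gfMatrix X Y q a c).det := by
  rw [dentedRegion_eq_stripRegion, gfMatrix_eq_pathMatrix]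
  refine tilingGF_stripRegion_eq_det X Y q (x + N) ⟨le_rfl, ?_, ?_, ?_, ?_, ?_, ?_, ?_⟩ ?_ ?_ ?_
  · exact fun i j hij => by exact_mod_cast ha hij
  · exact fun i j hij => by exact_mod_cast hc hij
  · exact fun i => by exact_mod_cast hx i
  · exact fun i => by positivity
  · exact fun i => by exact_mod_cast (hac i).trans_lt (hN i)
  · exact fun i => by exact_mod_cast (hx i).trans (hac i)
  · exact fun i => by exact_mod_cast hN i
  · exact fun i => by positivity
  · intro j hj
    have := hac j
    exact ⟨j, by omega⟩
  · push_cast; omega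

theorem familyGF_eq_det {K : Type*} [Field K] (X Y q : K) {n : ℕ} {a c : Fin n → ℕ}
    (ha : StrictMono a) (hc : StrictMono c) :
    familyGF X Y q a c = (gfMatrix X Y q a c).det := by
  rw [familyGF_eq, gfMatrix_eq_pathMatrix,
    ← disjointFamilyGF_eq_det X Y q ((Finset.univ.sup c) + 1)]
  · simp [levelPoint]
  · exact fun i j hij => by exact_mod_cast ha hij
  · exact fun i j hij => by exact_mod_cast hc hij
  · exact fun i => by positivity
  · intro i
    have : c i ≤ Finset.univ.sup c := Finset.le_sup (Finset.mem_univ i)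
    push_cast
    omega


/-! ### The determinant does not vanish for indeterminates -/

section Nonvanishing

variable {K : Type*} [Field K] (X Y q : K)

/-- Up to powers of `2` and `q`, the element `z` is the value in `X, Y, q` of an integer
polynomial that takes a positive value in `1, 1, 1`. -/
def IsPositive (z : K) : Prop :=
  ∃ (M N : ℕ) (P : MvPolynomial (Fin 3) ℤ), 2 ^ M * q ^ N * z = MvPolynomial.aeval ![X, Y, q] P ∧
    0 < MvPolynomial.eval 1 P

variable {X Y q}

theorem IsPositive.one : IsPositive X Y q 1 := ⟨0, 0, 1, by simp, by simp⟩

theorem IsPositive.mul {z w : K} (hz : IsPositive X Y q z) (hw : IsPositive X Y q w) :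
    IsPositive X Y q (z * w) := by
  obtain ⟨M, N, P, h, hp⟩ := hz
  obtain ⟨M', N', P', h', hp'⟩ := hw
  refine ⟨M + M', N + N', P * P', ?_, by rw [map_mul]; positivity⟩
  rw [map_mul, ← h, ← h']
  ring

theorem IsPositive.add {z w : K} (hz : IsPositive X Y q z) (hw : IsPositive X Y q w) :
    IsPositive X Y q (z + w) := by
  obtain ⟨M, N, P, h, hp⟩ := hz
  obtain ⟨M', N', P', h', hp'⟩ := hw
  refine ⟨M + M', N + N', 2 ^ M' * MvPolynomial.X 2 ^ N' * P + 2 ^ M * MvPolynomial.X 2 ^ N * P',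
    ?_, ?_⟩
  · simp only [map_add, map_mul, map_pow, map_ofNat, MvPolynomial.aeval_X, ← h, ← h']
    simp
    ring
  · simp only [map_add, map_mul, map_pow, map_ofNat, MvPolynomial.eval_X, Pi.one_apply]
    positivity

theorem IsPositive.prod {ι : Type*} (s : Finset ι) {f : ι → K}
    (h : ∀ i ∈ s, IsPositive X Y q (f i)) : IsPositive X Y q (∏ i ∈ s, f i) :=
  Finset.prod_induction f _ (fun _ _ => IsPositive.mul) IsPositive.one h

theorem IsPositive.sum {ι : Type*} {s : Finset ι} (hs : s.Nonempty) {f : ι → K}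
    (h : ∀ i ∈ s, IsPositive X Y q (f i)) : IsPositive X Y q (∑ i ∈ s, f i) :=
  Finset.sum_induction_nonempty f _ (fun _ _ => IsPositive.add) hs h

/-- If $z=0$, independence forces the polynomial itself to be zero, against its positive value at
$(1,1,1)$. -/
theorem IsPositive.ne_zero (hXYq : AlgebraicIndependent ℤ ![X, Y, q]) {z : K}
    (hz : IsPositive X Y q z) : z ≠ 0 := by
  rintro rfl
  obtain ⟨M, N, P, h, hp⟩ := hz
  rw [mul_zero, ← map_zero (MvPolynomial.aeval (R := ℤ) ![X, Y, q])] at h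
  rw [← hXYq h, map_zero] at hp
  exact hp.false

theorem isPositive_labelWeight (h2 : (2 : K) ≠ 0) (hq0 : q ≠ 0) (v : ℤ) :
    IsPositive X Y q (labelWeight X Y q v) := by
  -- $2q^{|v|}w_v = Xq^{|v|+v}+Yq^{|v|-v}$ has non-negative exponents and value 2 at $(1,1,1)$.
  refine ⟨1, v.natAbs, MvPolynomial.X 0 * MvPolynomial.X 2 ^ (v.natAbs + v).toNat +
    MvPolynomial.X 1 * MvPolynomial.X 2 ^ (v.natAbs - v).toNat, ?_, by simp⟩
  have h (u : ℤ) (hu : 0 ≤ v.natAbs + u) : q ^ (v.natAbs + u).toNat = q ^ v.natAbs * q ^ u := by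
    rw [← zpow_natCast q (Int.toNat _), Int.toNat_of_nonneg hu, zpow_add₀ hq0, zpow_natCast]
  simp only [map_add, map_mul, map_pow, MvPolynomial.aeval_X, labelWeight]
  simp only [Matrix.cons_val]
  rw [h v (by omega), sub_eq_add_neg, h (-v) (by omega)]
  field_simp

theorem isPositive_walkWeight (h2 : (2 : K) ≠ 0) (hq0 : q ≠ 0) (w : List Step) (P : ℤ × ℤ) :
    IsPositive X Y q (walkWeight X Y q P w) := by
  induction w generalizing P with
  | nil => exact IsPositive.one
  | cons s w ih =>
    refine IsPositive.mul ?_ (ih _)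
    cases s
    · exact isPositive_labelWeight h2 hq0 _
    · exact IsPositive.one

end Nonvanishing

/-! ### An explicit non-intersecting family -/

theorem endpoint_replicate_right (m : ℕ) (P : ℤ × ℤ) (w : List Step) :
    endpoint P (List.replicate m Step.right ++ w) = endpoint (P.1 + m, P.2) w := by
  induction m generalizing P with
  | zero => simp
  | succ m ih =>
    rw [List.replicate_succ, List.cons_append, endpoint, ih]
    simp only [Step.move]
    congr 2; push_cast; ring

theorem endpoint_replicate_down (m : ℕ) (P : ℤ × ℤ) :
    endpoint P (List.replicate m Step.down) = (P.1, P.2 - m) := by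
  induction m generalizing P with
  | zero => simp [endpoint]
  | succ m ih =>
    rw [List.replicate_succ, endpoint, ih]
    simp only [Step.move]
    congr 1; push_cast; ring

theorem mem_points_replicate_down {m : ℕ} {P R : ℤ × ℤ}
    (h : R ∈ points P (List.replicate m Step.down)) : R.1 = P.1 ∧ R.2 ≤ P.2 := by
  induction m generalizing P with
  | zero => simp_all [points]
  | succ m ih =>
    rw [List.replicate_succ, points, List.mem_cons] at h
    obtain rfl | h := h
    · simp
    · have := ih h
      simp only [Step.move] at this
      omega

theorem mem_points_replicate_right {m m' : ℕ} {P R : ℤ × ℤ}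
    (h : R ∈ points P (List.replicate m Step.right ++ List.replicate m' Step.down)) :
    (R.1 ≤ P.1 + m ∧ R.2 = P.2) ∨ (R.1 = P.1 + m ∧ R.2 ≤ P.2) := by
  induction m generalizing P with
  | zero => exact Or.inr (by simpa using mem_points_replicate_down h)
  | succ m ih =>
    rw [List.replicate_succ, List.cons_append, points, List.mem_cons] at h
    obtain rfl | h := h
    · left; push_cast; omega
    · have := ih h
      simp only [Step.move] at this
      push_cast
      omega

/-- The paths that go right at height $a_i$ and then down the column $c_i$ are nested hooks: a
larger index lies higher and further right. -/
theorem nonempty_nonIntersectingFamily {n : ℕ} {a c : Fin n → ℕ} (ha : StrictMono a)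
    (hc : StrictMono c) (hac : ∀ i, a i ≤ c i) : Nonempty (NonIntersectingFamily a c) := by
  have key : ∀ i j, i < j → List.Disjoint
      (points ((a i : ℤ), (a i : ℤ))
        (List.replicate (c i - a i) Step.right ++ List.replicate (a i) Step.down))
      (points ((a j : ℤ), (a j : ℤ))
        (List.replicate (c j - a j) Step.right ++ List.replicate (a j) Step.down)) := by
    intro i j hij R h h'
    have h1 := mem_points_replicate_right h
    have h2 := mem_points_replicate_right h'
    have := ha hij
    have := hc hij
    have := hac i
    have := hac j
    simp only at h1 h2
    omega
  refine ⟨⟨fun i => ⟨List.replicate (c i - a i) Step.right ++ List.replicate (a i) Step.down, ?_⟩,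
    fun i j hij => ?_⟩⟩
  · have := hac i
    rw [endpoint_replicate_right, endpoint_replicate_down]
    simp only [Prod.mk.injEq]
    omega
  · obtain h | h := lt_or_gt_of_ne hij
    · exact key i j h
    · exact (key j i h).symm

theorem familyGF_ne_zero {K : Type*} [Field K] {X Y q : K} (h2 : (2 : K) ≠ 0) (hq0 : q ≠ 0)
    (hXYq : AlgebraicIndependent ℤ ![X, Y, q]) {n : ℕ} {a c : Fin n → ℕ} (ha : StrictMono a)
    (hc : StrictMono c) (hac : ∀ i, a i ≤ c i) : familyGF X Y q a c ≠ 0 := by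
  have := nonempty_nonIntersectingFamily ha hc hac
  refine IsPositive.ne_zero hXYq (IsPositive.sum Finset.univ_nonempty fun F _ => ?_)
  exact IsPositive.prod _ fun i _ => isPositive_walkWeight h2 hq0 _ _

end HalfHexagon

end

theorem mainTheorem1 {K : Type*} [Field K] (X Y q : K) (h2 : (2 : K) ≠ 0) (hq0 : q ≠ 0)
    (hq : ∀ j : ℕ, 0 < j → q ^ (2 * j) ≠ 1)
    (k : ℕ) (hk : 0 < k) (n : ℕ) (a c : Fin n → ℕ)
    (ha : StrictMono a) (hc : StrictMono c) (hac : ∀ i, a i ≤ c i) :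
    -- the determinant in the denominator does not vanish for indeterminates
    (AlgebraicIndependent ℤ ![X, Y, q] →
      (HalfHexagon.gfMatrix X Y q a c).det ≠ 0) ∧
    -- the quotient of the determinants
    ((HalfHexagon.gfMatrix X Y q a c).det ≠ 0 →
      (HalfHexagon.gfMatrix X Y q (fun i => a i + k) (fun i => c i + k)).det /
        (HalfHexagon.gfMatrix X Y q a c).det = HalfHexagon.widthFactor q k a c) ∧
    (HalfHexagon.gfMatrix X Y q (fun i => a i + k) (fun i => c i + k)).det =
      HalfHexagon.widthFactor q k a c * (HalfHexagon.gfMatrix X Y q a c).det ∧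
    -- the determinant counts families of non-intersecting lattice paths
    HalfHexagon.familyGF X Y q a c = (HalfHexagon.gfMatrix X Y q a c).det ∧
    -- it counts lozenge tilings, whose generating function changes by the same factor
    ∀ x N : ℕ, (∀ i, x ≤ a i) → (∀ i, c i < x + N) →
      HalfHexagon.tilingGF X Y q (HalfHexagon.dentedRegion x N a c) =
        (HalfHexagon.gfMatrix X Y q a c).det ∧
      (HalfHexagon.tilingGF X Y q (HalfHexagon.dentedRegion x N a c) ≠ 0 →
        HalfHexagon.tilingGF X Y q
            (HalfHexagon.dentedRegion (x + k) N (fun i => a i + k) (fun i => c i + k)) /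
          HalfHexagon.tilingGF X Y q (HalfHexagon.dentedRegion x N a c) =
            HalfHexagon.widthFactor q k a c) ∧
      HalfHexagon.tilingGF X Y q
          (HalfHexagon.dentedRegion (x + k) N (fun i => a i + k) (fun i => c i + k)) =
        HalfHexagon.widthFactor q k a c *
          HalfHexagon.tilingGF X Y q (HalfHexagon.dentedRegion x N a c) := by
  have hdet := HalfHexagon.det_gfMatrix_add X Y h2 hq0 hq hk a c
  have hfam := HalfHexagon.familyGF_eq_det X Y q ha hc
  refine ⟨fun h => ?_, fun h => ?_, hdet, hfam, fun x N hx hN => ?_⟩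
  · rw [← hfam]
    exact HalfHexagon.familyGF_ne_zero h2 hq0 h ha hc hac
  · rw [hdet, mul_div_cancel_right₀ _ h]
  · have htil := HalfHexagon.tilingGF_eq_det X Y q ha hc hac hx hN
    have htil' := HalfHexagon.tilingGF_eq_det X Y q (a := fun i => a i + k)
      (c := fun i => c i + k) (fun i j hij => Nat.add_lt_add_right (ha hij) k)
      (fun i j hij => Nat.add_lt_add_right (hc hij) k) (fun i => Nat.add_le_add_right (hac i) k)
      (fun i => Nat.add_le_add_right (hx i) k)
      (N := N) (fun i => by have := hN i; omega)
    have hshift := htil'.trans (hdet.trans (congrArg _ htil.symm))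
    exact ⟨htil, fun h => by rw [hshift, mul_div_cancel_right₀ _ h], hshift⟩
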